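/- **Conventions.** A *complex* is a finite simplicial complex of dimension at most $2$ embedded in some Euclidean space $\mathbb R^N$; different embeddings count as different complexes. For a vertex $v$ of $K$, $\mathrm{star}(v,K)$ is the closed star (all faces of simplices containing $v$) and $\mathrm{link}(v,K)$ is the subcomplex of its simplices that do not contain $v$; $f_i(K)$ is the number of $i$-simplices. For an edge $\langle v,w\rangle$, $m_{wv}$ is the number of $2$-simplices of $K$ containing it. Angles $\angle(v,\sigma^2)$ of triangles are normalized so that a full circle is $1$. Stars $\mathrm{star}(v,K)$ and $\mathrm{star}(w,L)$ are *simplicially isometric* if there is a simplicial homeomorphism between them that preserves the lengths of edges and takes $v$ to $w$. A *planar fan* is a simplicial disk in $\mathbb R^2$ with no interior vertices that is a cone from one of its boundary vertices. For $n\ge 0$, an *$n$-flap* is a complex with an edge $\langle v,w\rangle$ and exactly $n$ $2$-simplices, each having $\langle v,w\rangle$ as an edge, such that every simplex is a face of $\langle v,w\rangle$ or of one of these $2$-simplices. **Theorem.** Let $\mathcal T$ be a set of complexes that contains all planar fans, that contains $\mathrm{star}(v,K)$ for every $K\in\mathcal T$ and every vertex $v$ of $K$, and that contains every subdivision of each of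 its members. Let $\Lambda$ assign a real number $\Lambda(K)$ to each $K\in\mathcal T$, and let $\phi$ assign a real number $\phi(v,K)$ to each $K\in\mathcal T$ and each vertex $v$ of $K$. Suppose that $\Lambda$ is geometrically locally determined by $\phi$, that is: 1. if $K,L\in\mathcal T$ and $\mathrm{star}(v,K)$, $\mathrm{star}(w,L)$ are simplicially isometric, then $\phi(v,K)=\phi(w,L)$; 2. if $K,J\in\mathcal T$, $J$ is a subdivision of $K$ and $v$ is a vertex of $K$, then $\phi(v,K)=\phi(v,J)$; 3. if $K,K_1,K_2,\ldots\in\mathcal T$ lie in the same $\mathbb R^N$, are combinatorially equivalent by given simplicial isomorphisms $K\to K_n$, and each vertex of $K$ is the limit of the corresponding vertices of the $K_n$, then $\phi(v_n,K_n)\to\phi(v,K)$ for each vertex $v$ of $K$ with corresponding vertices $v_n$; 4. $\sum_{v}\phi(v,K)=\Lambda(K)$ for every $K\in\mathcal T$, the sum being over all vertices of $K$. Suppose also that $\Lambda$ is constant on the set of all planar fans, with value $\Lambda(\mathrm{fan})$, and that for each $n\ge 0$ it is constant on the set of all $n$-flaps in $\mathcal T$, with value $\Lambda(n\text{-flap})$.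 Then for each $K\in\mathcal T$ and each vertex $v$ of $K$, $$\phi(v,K)=\Lambda(\mathrm{star}(v,K))-\tfrac12\sum_{w\in \mathrm{link}(v,K)}\Lambda(m_{wv}\text{-flap})+\tfrac12\,\Lambda(\mathrm{fan})\,f_1(\mathrm{link}(v,K))-\Lambda(\mathrm{fan})\sum_{\sigma^2\ni v}\angle(v,\sigma^2),$$ where the first sum is over the vertices $w$ of $\mathrm{link}(v,K)$ and the second over the $2$-simplices $\sigma^2$ of $K$ containing $v$. -/

import Mathlib

/-- A finite simplicial complex of dimension at most two, embedded in the Euclidean space `ℝ^N`.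
(A "2-dimensional simplicial complex" may be a single vertex, a single edge, and so on.)
A simplex is given by the finite set of its vertices. -/
structure Complex2 (N : ℕ) extends Geometry.SimplicialComplex ℝ (EuclideanSpace ℝ (Fin N)) where
  finite_faces : faces.Finite
  card_le_three : ∀ s ∈ faces, s.card ≤ 3

namespace Complex2

variable {N M : ℕ}

/-- The finite set of vertices. -/
noncomputable def verts (K : Complex2 N) : Finset (EuclideanSpace ℝ (Fin N)) :=
  K.finite_faces.toFinset.biUnion id

theorem mem_verts (K : Complex2 N) (x : EuclideanSpace ℝ (Fin N)) :
    x ∈ K.verts ↔ {x} ∈ K.faces := by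
  classical
  simp only [verts, Finset.mem_biUnion, Set.Finite.mem_toFinset, id]
  constructor
  · rintro ⟨s, hs, hx⟩
    exact K.down_closed hs (Finset.singleton_subset_iff.2 hx) (Finset.singleton_nonempty x)
  · intro h
    exact ⟨{x}, h, Finset.mem_singleton_self x⟩

/-- The underlying space of the complex. -/
abbrev carrier (K : Complex2 N) : Set (EuclideanSpace ℝ (Fin N)) :=
  K.toSimplicialComplex.space

/-- The finite set of `i`-simplices. -/
noncomputable def simplices (K : Complex2 N) (i : ℕ) :
    Finset (Finset (EuclideanSpace ℝ (Fin N))) :=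
  K.finite_faces.toFinset.filter (fun s => s.card = i + 1)

/-- The number `f_i(K)` of `i`-simplices. -/
noncomputable def faceCount (K : Complex2 N) (i : ℕ) : ℕ := (K.simplices i).card

/-- The finite set of 2-simplices that contain the vertex `v`. -/
noncomputable def trianglesAt (K : Complex2 N) (v : EuclideanSpace ℝ (Fin N)) :
    Finset (Finset (EuclideanSpace ℝ (Fin N))) :=
  (K.simplices 2).filter (fun s => v ∈ s)

/-- The number of 2-simplices that contain both `v` and `w`, that is, which contain the
edge `⟨v, w⟩`. -/
noncomputable def edgeOrder (K : Complex2 N) (v w : EuclideanSpace ℝ (Fin N)) : ℕ :=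
  ((K.trianglesAt v).filter (fun s => w ∈ s)).card

/-- The (closed) star of a vertex `v`: the simplices of `K` that are faces of a simplex of `K`
containing `v`. -/
def closedStar (K : Complex2 N) (v : EuclideanSpace ℝ (Fin N)) : Complex2 N where
  faces := {s | s ∈ K.faces ∧ insert v s ∈ K.faces}
  isRelLowerSet_faces := by
    rintro s ⟨hs, hvs⟩
    refine ⟨K.nonempty_of_mem_faces hs, fun t hts ht => ?_⟩
    exact ⟨K.down_closed hs hts ht,
      K.down_closed hvs (Finset.insert_subset_insert v hts) (Finset.insert_nonempty v t)⟩
  indep := fun hs => K.indep hs.1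
  inter_subset_convexHull := fun hs ht => K.inter_subset_convexHull hs.1 ht.1
  finite_faces := K.finite_faces.subset (fun _ hs => hs.1)
  card_le_three := fun s hs => K.card_le_three s hs.1

/-- The link of a vertex `v`: the simplices of the star of `v` that do not contain `v`. -/
def link (K : Complex2 N) (v : EuclideanSpace ℝ (Fin N)) : Complex2 N where
  faces := {s | s ∈ K.faces ∧ insert v s ∈ K.faces ∧ v ∉ s}
  isRelLowerSet_faces := by
    rintro s ⟨hs, hvs, hv⟩
    refine ⟨K.nonempty_of_mem_faces hs, fun t hts ht => ?_⟩
    exact ⟨K.down_closed hs hts ht,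
      K.down_closed hvs (Finset.insert_subset_insert v hts) (Finset.insert_nonempty v t),
      fun h => hv (hts h)⟩
  indep := fun hs => K.indep hs.1
  inter_subset_convexHull := fun hs ht => K.inter_subset_convexHull hs.1 ht.1
  finite_faces := K.finite_faces.subset (fun _ hs => hs.1)
  card_le_three := fun s hs => K.card_le_three s hs.1

/-- `J` is a subdivision of `K`: they have the same underlying space, and every simplex of `J`
lies in a simplex of `K`. -/
def IsSubdivision (J K : Complex2 N) : Prop :=
  J.carrier = K.carrier ∧
    ∀ s ∈ J.faces, ∃ t ∈ K.faces,
      convexHull ℝ (s : Set (EuclideanSpace ℝ (Fin N))) ⊆ convexHull ℝ (t : Set _)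

/-- `g` is the vertex map of a simplicial homeomorphism `|K| → |L|` (the homeomorphism is its
affine extension to the simplices): a bijection of the vertices under which the simplices of `K`
and those of `L` correspond. -/
def IsSimplicialIso (K : Complex2 N) (L : Complex2 M)
    (g : EuclideanSpace ℝ (Fin N) → EuclideanSpace ℝ (Fin M)) : Prop :=
  Set.BijOn g K.verts L.verts ∧
    ∀ s : Finset (EuclideanSpace ℝ (Fin N)), s ⊆ K.verts → (s ∈ K.faces ↔ s.image g ∈ L.faces)

/-- `g` is the vertex map of a simplicial isometry `|K| → |L|`: a simplicial homeomorphism that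
preserves the lengths of edges. -/
def IsSimplicialIsometry (K : Complex2 N) (L : Complex2 M)
    (g : EuclideanSpace ℝ (Fin N) → EuclideanSpace ℝ (Fin M)) : Prop :=
  IsSimplicialIso K L g ∧ ∀ a b, {a, b} ∈ K.faces → dist (g a) (g b) = dist a b

/-- The stars of `v` in `K` and of `w` in `L` are simplicially isometric, by a simplicial isometry
that takes `v` to `w`. -/
def StarsIsometric (K : Complex2 N) (v : EuclideanSpace ℝ (Fin N))
    (L : Complex2 M) (w : EuclideanSpace ℝ (Fin M)) : Prop :=
  ∃ g, IsSimplicialIsometry (K.closedStar v) (L.closedStar w) g ∧ g v = w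

/-- An `n`-flap with end-vertices `v` and `w`: `⟨v, w⟩` is an edge, there are exactly `n`
2-simplices, all of them have `⟨v, w⟩` as an edge, and there are no simplices other than these
2-simplices, the edge `⟨v, w⟩`, and their faces. -/
def IsFlapWithEnds (n : ℕ) (K : Complex2 N) (v w : EuclideanSpace ℝ (Fin N)) : Prop :=
  v ≠ w ∧ {v, w} ∈ K.faces ∧ K.faceCount 2 = n ∧ (∀ s ∈ K.simplices 2, v ∈ s ∧ w ∈ s) ∧
    ∀ s ∈ K.faces, s ⊆ {v, w} ∨ ∃ t ∈ K.simplices 2, s ⊆ t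

/-- An `n`-flap. -/
def IsFlap (n : ℕ) (K : Complex2 N) : Prop :=
  ∃ v w, IsFlapWithEnds n K v w

/-- A planar fan: a simplicial disk in `ℝ²` with no interior vertices (the boundary of a disk
in `ℝ²` is its frontier) that is triangulated as a cone from one of its boundary vertices `c`. -/
def IsPlanarFan (K : Complex2 2) : Prop :=
  Nonempty (K.carrier ≃ₜ Metric.closedBall (0 : EuclideanSpace ℝ (Fin 2)) 1) ∧
    (∀ x ∈ K.verts, x ∈ frontier K.carrier) ∧
    ∃ c ∈ K.verts, ∀ s ∈ K.faces, insert c s ∈ K.faces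

end Complex2

/-- The angle at the vertex `v` of the triangle with vertex set `s`, normalized so that a full
circle has angle `1`. (The double sum counts the angle, of measure `∠ a v b`, twice.) -/
noncomputable def normAngle {N : ℕ} (v : EuclideanSpace ℝ (Fin N))
    (s : Finset (EuclideanSpace ℝ (Fin N))) : ℝ :=
  (∑ a ∈ s.erase v, ∑ b ∈ (s.erase v).erase a, EuclideanGeometry.angle a v b) / 2 /
    (2 * Real.pi)

theorem normAngle_triple {N : ℕ} {v a b : EuclideanSpace ℝ (Fin N)}
    (hva : v ≠ a) (hvb : v ≠ b) (hab : a ≠ b) :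
    normAngle v {v, a, b} = EuclideanGeometry.angle a v b / (2 * Real.pi) := by
  have h1 : ({v, a, b} : Finset (EuclideanSpace ℝ (Fin N))).erase v = {a, b} := by
    rw [Finset.erase_insert]
    simp [hva, hvb]
  have h2 : ({a, b} : Finset (EuclideanSpace ℝ (Fin N))).erase a = {b} := by
    rw [Finset.erase_insert]
    simp [hab]
  have h3 : ({a, b} : Finset (EuclideanSpace ℝ (Fin N))).erase b = {a} := by
    rw [Finset.pair_comm, Finset.erase_insert]
    simp [hab.symm]
  unfold normAngle
  rw [h1, Finset.sum_pair hab, h2, h3, Finset.sum_singleton, Finset.sum_singleton,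
    EuclideanGeometry.angle_comm b v a]
  ring

/-- A set of 2-dimensional simplicial complexes in Euclidean spaces: the members in `ℝ^N`,
for every `N`. -/
abbrev ComplexClass : Type := ∀ N : ℕ, Set (Complex2 N)

/-- A real number for every complex. Only the values on a given class are ever used, so these
represent the simplicial-complex-supported functions on that class. -/
abbrev ComplexFunction : Type := ∀ N : ℕ, Complex2 N → ℝ

/-- A real number for every complex and every point. Only the values on the members of a given
class and their vertices are ever used, so these represent the vertex-supported functions on
that class. -/
abbrev VertexFunction : Type := ∀ N : ℕ, Complex2 N → EuclideanSpace ℝ (Fin N) → ℝ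

namespace ComplexClass

/-- Every star of a vertex of a member is a member. -/
def StarClosed (T : ComplexClass) : Prop :=
  ∀ (N : ℕ), ∀ K ∈ T N, ∀ v ∈ K.verts, K.closedStar v ∈ T N

/-- Every subdivision of a member is a member. -/
def SubdivisionClosed (T : ComplexClass) : Prop :=
  ∀ (N : ℕ), ∀ K ∈ T N, ∀ J : Complex2 N, J.IsSubdivision K → J ∈ T N

end ComplexClass

namespace VertexFunction

def InvariantUnderSubdivision (T : ComplexClass) (φ : VertexFunction) : Prop :=
  ∀ (N : ℕ), ∀ K ∈ T N, ∀ J ∈ T N, ∀ v ∈ K.verts, J.IsSubdivision K → φ N K v = φ N J v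

def InvariantUnderStarIsometries (T : ComplexClass) (φ : VertexFunction) : Prop :=
  ∀ (N M : ℕ), ∀ K ∈ T N, ∀ L ∈ T M, ∀ v ∈ K.verts, ∀ w ∈ L.verts,
    K.StarsIsometric v L w → φ N K v = φ M L w

/-- Continuity: whenever members `Kₙ` of the class in the same `ℝ^N` are identified with `K` by
simplicial isomorphisms `gₙ`, and every vertex `gₙ x` of `Kₙ` converges to the vertex `x` of `K`,
the values at corresponding vertices converge. -/
def IsContinuous (T : ComplexClass) (φ : VertexFunction) : Prop :=
  ∀ (N : ℕ), ∀ K ∈ T N, ∀ (Kn : ℕ → Complex2 N)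
    (g : ℕ → EuclideanSpace ℝ (Fin N) → EuclideanSpace ℝ (Fin N)),
    (∀ n, Kn n ∈ T N) → (∀ n, K.IsSimplicialIso (Kn n) (g n)) →
    (∀ x ∈ K.verts, Filter.Tendsto (fun n => g n x) Filter.atTop (nhds x)) →
    ∀ v ∈ K.verts,
      Filter.Tendsto (fun n => φ N (Kn n) (g n v)) Filter.atTop (nhds (φ N K v))

/-- The Descartes-Gauss-Bonnet Theorem with respect to `Λ`. -/
def SatisfiesDGB (T : ComplexClass) (φ : VertexFunction) (Λ : ComplexFunction) : Prop :=
  ∀ (N : ℕ), ∀ K ∈ T N, ∑ v ∈ K.verts, φ N K v = Λ N K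

end VertexFunction

/-- `Λ` is geometrically locally determined by `φ` on the class `T`. -/
def GeometricallyLocallyDeterminedBy (T : ComplexClass) (Λ : ComplexFunction)
    (φ : VertexFunction) : Prop :=
  VertexFunction.InvariantUnderStarIsometries T φ ∧
    VertexFunction.InvariantUnderSubdivision T φ ∧ VertexFunction.IsContinuous T φ ∧
    VertexFunction.SatisfiesDGB T φ Λ

/-! Condition 4 on the star of `v` expresses `φ` at `v` through `Λ` of the star and the values of
`φ` at the vertices `w` of the link. By star invariance, the value at `w` may be computed in the
star of `w` inside the star of `v`, and this complex is a flap on the edge `⟨w, v⟩`. So everything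
reduces to the value of `φ` at an end of a flap.

The main tool is radial rescaling. Subdividing an edge `⟨w, b⟩` of a cone with apex `w` and then
taking the star of `w` gives the same cone with `b` moved along the edge towards `w`. Neither
operation changes `φ` at `w`, so the vertices of a cone may be pulled independently towards the apex
(`exists_shrink`), and `φ` at the apex depends only on the combinatorics and the angles there
(`phi_eq_of_angles`).

For a triangle the value is therefore a function `h` of the angle. It is continuous, and its values
at the three angles of any triangle add up to `Λ(fan)`, so it is affine on `(0, π)`
(`affine_of_triangle_sum`). A vertex introduced in the interior of an edge of a planar triangle has
value 0, because the triangle and its subdivision are both fans. Approximating such a subdivision by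
kites and using continuity shows that the affine function vanishes at `π` (`angle_function_at_pi`).
Hence `h` is `Λ(fan) * (1/2 - angle)` with normalized angles (`phi_triangle`).

In a flap the star of each tip is a triangle, so the tips are known. If the angles at one end are
acute, rescaling makes all triangles isosceles; exchanging the ends is then an isometry, and
condition 4 gives the value at that end (`phi_flap_of_acute`). In general the tips are first pulled
towards `w`, which makes the angles at `v` acute; the value at `v` is then known, and condition 4
gives the value at `w` (`phi_flap`). Summing over the link and using the angle sum in each triangle
at `v` gives the formula. -/

/-- The total weight of a weight function on the points of a vector space, together with the
weighted sum of the points. -/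
noncomputable def bary (E : Type*) [AddCommGroup E] [Module ℝ E] : (E →₀ ℝ) →ₗ[ℝ] ℝ × E :=
  Finsupp.linearCombination ℝ (fun x : E => ((1 : ℝ), x))

/-! ### Barycentric coordinates as finitely supported weights -/

section Barycentric

variable {E : Type*} [AddCommGroup E] [Module ℝ E]

theorem bary_single (x : E) (c : ℝ) : bary E (Finsupp.single x c) = (c, c • x) := by
  simp [bary]

theorem bary_eq_sum {w : E →₀ ℝ} {s : Finset E} (h : w.support ⊆ s) :
    bary E w = (∑ x ∈ s, w x, ∑ x ∈ s, w x • x) := by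
  rw [bary, Finsupp.linearCombination_apply, Finsupp.sum_of_support_subset _ h _ (by simp)]
  ext
  · simp [Prod.fst_sum]
  · simp [Prod.snd_sum]

theorem mem_convexHull_iff_bary {s : Finset E} {x : E} :
    x ∈ convexHull ℝ (s : Set E) ↔
      ∃ w : E →₀ ℝ, 0 ≤ w ∧ w.support ⊆ s ∧ bary E w = (1, x) := by
  classical
  rw [Finset.mem_convexHull']
  constructor
  · rintro ⟨w, h0, h1, hx⟩
    have hs : (Finsupp.onFinset s (fun y => if y ∈ s then w y else 0) (by simp +contextual)).support ⊆ s :=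
      Finsupp.support_onFinset_subset
    refine ⟨_, fun y => ?_, hs, ?_⟩
    · by_cases hy : y ∈ s <;> simp [hy, h0]
    · rw [bary_eq_sum hs, ← h1, ← hx]
      congr 1 <;> exact Finset.sum_congr rfl fun y hy => by simp [hy]
  · rintro ⟨w, h0, hs, hw⟩
    rw [bary_eq_sum hs, Prod.mk.injEq] at hw
    exact ⟨w, fun y _ => h0 y, hw.1, hw.2⟩

theorem affineIndependent_iff_bary {s : Finset E} :
    AffineIndependent ℝ ((↑) : s → E) ↔
      ∀ w : E →₀ ℝ, w.support ⊆ s → bary E w = 0 → w = 0 := by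
  classical
  rw [affineIndependent_iff]
  constructor
  · intro h w hs hw
    rw [bary_eq_sum hs, Prod.mk_eq_zero] at hw
    ext x
    by_cases hx : x ∈ s
    · refine h Finset.univ (fun y => w y) ?_ ?_ ⟨x, hx⟩ (Finset.mem_univ _)
      · rw [← hw.1]
        exact Finset.sum_coe_sort s (fun y => w y)
      · rw [← hw.2]
        exact Finset.sum_coe_sort s (fun y => w y • y)
    · exact Finsupp.notMem_support_iff.1 fun h' => hx (hs h')
  · intro h t w h0 h1 x hx
    let u : s →₀ ℝ := Finsupp.onFinset t (fun y => if y ∈ t then w y else 0) (by simp +contextual)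
    have hu : (u.mapDomain ((↑) : s → E)) = 0 := by
      refine h _ ?_ ?_
      · intro y hy
        have := Finsupp.mapDomain_support hy
        obtain ⟨z, -, rfl⟩ := Finset.mem_image.1 this
        exact z.2
      · rw [bary, Finsupp.linearCombination_mapDomain, Finsupp.linearCombination_apply,
          Finsupp.sum_of_support_subset (s := t) _ Finsupp.support_onFinset_subset _ (by simp)]
        ext
        · simp only [Prod.fst_sum, Prod.fst_zero]
          refine Eq.trans ?_ h0
          exact Finset.sum_congr rfl fun y hy => by simp [hy]
        · simp only [Prod.snd_sum, Prod.snd_zero]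
          refine Eq.trans ?_ h1
          exact Finset.sum_congr rfl fun y hy => by simp [hy]
    have hx' := Finsupp.mapDomain_apply Subtype.val_injective u x
    rw [hu] at hx'
    simpa [u, hx] using hx'.symm

/-- Every point of the space of a family of simplices has unique barycentric coordinates. -/
def UniqueBary (F : Set (Finset E)) : Prop :=
  ∀ s ∈ F, ∀ t ∈ F, ∀ w w' : E →₀ ℝ, 0 ≤ w → 0 ≤ w' → w.support ⊆ s → w'.support ⊆ t →
    bary E w = bary E w' → w = w'

/-- An affine relation is the difference of its positive and negative parts. These are two
nonnegative weights on `s` with the same image under `bary`, hence equal. -/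
theorem UniqueBary.indep {F : Set (Finset E)} (h : UniqueBary F) {s : Finset E} (hs : s ∈ F) :
    AffineIndependent ℝ ((↑) : s → E) := by
  rw [affineIndependent_iff_bary]
  intro w hw h0
  let w1 : E →₀ ℝ := w.mapRange (fun c => max c 0) (by simp)
  let w2 : E →₀ ℝ := w.mapRange (fun c => max (-c) 0) (by simp)
  have hsub : w = w1 - w2 := by
    ext x
    simp only [w1, w2, Finsupp.sub_apply, Finsupp.mapRange_apply]
    rcases le_total 0 (w x) with h | h
    · rw [max_eq_left h, max_eq_right (by linarith)]; ring
    · rw [max_eq_right h, max_eq_left (by linarith)]; ring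
  have h12 : w1 = w2 := by
    refine h s hs s hs w1 w2 (fun x => by simp [w1]) (fun x => by simp [w2])
      (Finsupp.support_mapRange.trans hw) (Finsupp.support_mapRange.trans hw) ?_
    rwa [hsub, map_sub, sub_eq_zero] at h0
  rw [hsub, h12, sub_self]

theorem UniqueBary.inter_subset {F : Set (Finset E)} (h : UniqueBary F) {s t : Finset E}
    (hs : s ∈ F) (ht : t ∈ F) :
    convexHull ℝ (s : Set E) ∩ convexHull ℝ (t : Set E) ⊆ convexHull ℝ (s ∩ t : Set E) := by
  classical
  rintro x ⟨hxs, hxt⟩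
  obtain ⟨w, hw0, hws, hw⟩ := mem_convexHull_iff_bary.1 hxs
  obtain ⟨w', hw0', hwt, hw'⟩ := mem_convexHull_iff_bary.1 hxt
  have e := h s hs t ht w w' hw0 hw0' hws hwt (hw.trans hw'.symm)
  rw [← Finset.coe_inter]
  exact mem_convexHull_iff_bary.2 ⟨w, hw0, Finset.subset_inter hws (e ▸ hwt), hw⟩

theorem eq_of_bary_eq_of_affineIndependent {s : Finset E}
    (hs : AffineIndependent ℝ ((↑) : s → E)) {w w' : E →₀ ℝ} (hw : w.support ⊆ s)
    (hw' : w'.support ⊆ s) (h : bary E w = bary E w') : w = w' := by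
  classical
  rw [← sub_eq_zero]
  refine affineIndependent_iff_bary.1 hs _ ?_ (by rw [map_sub, h, sub_self])
  exact Finsupp.support_sub.trans (Finset.union_subset hw hw')

theorem uniqueBary_of_affineIndependent {F : Set (Finset E)} {s : Finset E}
    (hs : AffineIndependent ℝ ((↑) : s → E)) (hF : ∀ t ∈ F, t ⊆ s) : UniqueBary F :=
  fun _ ht _ hu _ _ _ _ hwt hwu h =>
    eq_of_bary_eq_of_affineIndependent hs (hwt.trans (hF _ ht)) (hwu.trans (hF _ hu)) h

/-- With the two lemmas above, this makes unique nonnegative coordinates equivalent to the two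
geometric axioms of a complex, and such uniqueness is easier to verify for a subdivision. After
scaling to total weight 1, the common point lies in the hull of `s ∩ t`, and its coordinates there
must be those in `s` and those in `t`. -/
theorem Geometry.SimplicialComplex.uniqueBary (K : Geometry.SimplicialComplex ℝ E) :
    UniqueBary K.faces := by
  classical
  intro s hs t ht w w' hw hw' hws hwt h
  have hm : bary E w = (∑ x ∈ s, w x, ∑ x ∈ s, w x • x) := bary_eq_sum hws
  have hm' : bary E w' = (∑ x ∈ t, w' x, ∑ x ∈ t, w' x • x) := bary_eq_sum hwt
  have nn : 0 ≤ (bary E w).1 := by rw [hm]; exact Finset.sum_nonneg fun x _ => hw x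
  -- Nonnegative weights of total 0 vanish; otherwise the weights can be normalized.
  rcases nn.eq_or_lt with h0 | hpos
  · have aux : ∀ (u : E →₀ ℝ) (r : Finset E), 0 ≤ u → u.support ⊆ r → 0 = (bary E u).1 →
        u = 0 := by
      intro u r hu hr h0
      rw [bary_eq_sum hr] at h0
      ext x
      by_cases hx : x ∈ r
      · exact (Finset.sum_eq_zero_iff_of_nonneg (fun x _ => hu x)).1 h0.symm x hx
      · exact Finsupp.notMem_support_iff.1 fun h' => hx (hr h')
    rw [aux w s hw hws h0, aux w' t hw' hwt (h ▸ h0)]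
  · set c := (bary E w).1 with hc
    have hcne : c ≠ 0 := hpos.ne'
    have hci : 0 ≤ c⁻¹ := inv_nonneg.2 hpos.le
    have hx : ∀ u : E →₀ ℝ, bary E u = bary E w →
        bary E (c⁻¹ • u) = (1, c⁻¹ • (bary E w).2) := by
      intro u hu
      rw [map_smul, hu]
      ext
      · change c⁻¹ * (bary E w).1 = 1
        rw [← hc, inv_mul_cancel₀ hcne]
      · rfl
    have hsup : ∀ (u : E →₀ ℝ) (r : Finset E), u.support ⊆ r → (c⁻¹ • u).support ⊆ r :=
      fun u r hr => Finsupp.support_smul.trans hr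
    have hnn : ∀ u : E →₀ ℝ, 0 ≤ u → 0 ≤ c⁻¹ • u := fun u hu x => by
      simpa using mul_nonneg hci (hu x)
    have hxm := K.inter_subset_convexHull hs ht
      ⟨mem_convexHull_iff_bary.2 ⟨_, hnn w hw, hsup w s hws, hx w rfl⟩,
        mem_convexHull_iff_bary.2 ⟨_, hnn w' hw', hsup w' t hwt, hx w' h.symm⟩⟩
    rw [← Finset.coe_inter] at hxm
    obtain ⟨v, -, hv, hvx⟩ := mem_convexHull_iff_bary.1 hxm
    have e1 := eq_of_bary_eq_of_affineIndependent (K.indep hs) (hsup w s hws)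
      (hv.trans Finset.inter_subset_left) ((hx w rfl).trans hvx.symm)
    have e2 := eq_of_bary_eq_of_affineIndependent (K.indep ht) (hsup w' t hwt)
      (hv.trans Finset.inter_subset_right) ((hx w' h.symm).trans hvx.symm)
    have e3 := congrArg (fun u => c • u) (e1.trans e2.symm)
    simpa [smul_smul, hcne] using e3

end Barycentric

/-! ### Complexes given by unique barycentric coordinates -/

namespace Complex2

variable {N M : ℕ}

/-- A complex is determined by a finite family of simplices with unique barycentric coordinates. -/
def ofUniqueBary (F : Set (Finset (EuclideanSpace ℝ (Fin N)))) (hfin : F.Finite)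
    (hne : ∀ s ∈ F, s.Nonempty) (hdown : ∀ s ∈ F, ∀ t ⊆ s, t.Nonempty → t ∈ F)
    (hU : UniqueBary F) (hcard : ∀ s ∈ F, s.card ≤ 3) : Complex2 N where
  faces := F
  isRelLowerSet_faces := fun s hs => ⟨hne s hs, fun t hts ht => hdown s hs t hts ht⟩
  indep := hU.indep
  inter_subset_convexHull := hU.inter_subset
  finite_faces := hfin
  card_le_three := hcard

theorem subset_verts (K : Complex2 N) {s : Finset (EuclideanSpace ℝ (Fin N))}
    (hs : s ∈ K.faces) : s ⊆ K.verts := fun _ hx =>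
  (K.mem_verts _).2 (K.down_closed hs (Finset.singleton_subset_iff.2 hx)
    (Finset.singleton_nonempty _))

/-- The interior points of an edge are not vertices. -/
theorem lineMap_notMem_verts (K : Complex2 N) {a b : EuclideanSpace ℝ (Fin N)} {l : ℝ}
    (hab : {a, b} ∈ K.faces) (hne : a ≠ b) (h0 : 0 < l) (h1 : l < 1) :
    AffineMap.lineMap a b l ∉ K.verts := by
  intro hp
  rw [mem_verts] at hp
  -- A vertex in the interior of the edge would have two systems of coordinates: weight 1 on itself,
  -- and weights `1 - l`, `l` on the ends.
  have h := K.uniqueBary _ hab _ hp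
    (Finsupp.single a (1 - l) + Finsupp.single b l)
    (Finsupp.single (AffineMap.lineMap a b l) 1)
    (add_nonneg (Finsupp.single_nonneg.2 (by linarith)) (Finsupp.single_nonneg.2 h0.le))
    (Finsupp.single_nonneg.2 zero_le_one)
    (Finsupp.support_add.trans (Finset.union_subset
      (Finsupp.support_single_subset.trans (by simp))
      (Finsupp.support_single_subset.trans (by simp))))
    Finsupp.support_single_subset
    (by
      rw [map_add, bary_single, bary_single, bary_single, AffineMap.lineMap_apply_module]
      simp)
  have ha := DFunLike.congr_fun h a
  have hb := DFunLike.congr_fun h b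
  simp only [Finsupp.add_apply, Finsupp.single_apply, hne, hne.symm, if_true, if_false] at ha hb
  split_ifs at ha hb with h2 h3 h3
  · exact hne (h2.symm.trans h3)
  · linarith
  · linarith
  · linarith

end Complex2

/-! ### Subdividing an edge -/

namespace Complex2

variable {N M : ℕ}

/-- The simplices of the complex that results from `K` when the edge `⟨a, b⟩` is subdivided at its
interior point `p`. -/
def splitFaces (K : Complex2 N) (a b p : EuclideanSpace ℝ (Fin N)) :
    Set (Finset (EuclideanSpace ℝ (Fin N))) :=
  {s | ¬(a ∈ s ∧ b ∈ s) ∧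
    ((p ∉ s ∧ s ∈ K.faces) ∨ (p ∈ s ∧ insert a (insert b (s.erase p)) ∈ K.faces))}

/-- Replace the point `p` of the edge `⟨a, b⟩` by its barycentric coordinates. -/
noncomputable def edgePush (a b p : EuclideanSpace ℝ (Fin N)) (l : ℝ)
    (w : EuclideanSpace ℝ (Fin N) →₀ ℝ) : EuclideanSpace ℝ (Fin N) →₀ ℝ :=
  w + w p • (Finsupp.single a (1 - l) + Finsupp.single b l - Finsupp.single p 1)

theorem bary_edgePush (a b : EuclideanSpace ℝ (Fin N)) (l : ℝ)
    (w : EuclideanSpace ℝ (Fin N) →₀ ℝ) :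
    bary _ (edgePush a b (AffineMap.lineMap a b l) l w) = bary _ w := by
  have : bary (EuclideanSpace ℝ (Fin N)) (Finsupp.single a (1 - l) + Finsupp.single b l -
      Finsupp.single (AffineMap.lineMap a b l) 1) = 0 := by
    rw [map_sub, map_add, bary_single, bary_single, bary_single, AffineMap.lineMap_apply_module]
    simp
  rw [edgePush, map_add, map_smul, this, smul_zero, add_zero]

section Split

variable {K : Complex2 N} {a b : EuclideanSpace ℝ (Fin N)} {l : ℝ}

theorem edgePush_apply (w : EuclideanSpace ℝ (Fin N) →₀ ℝ) (p x : EuclideanSpace ℝ (Fin N)) :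
    edgePush a b p l w x = w x + w p * ((if a = x then 1 - l else 0) + (if b = x then l else 0) -
      (if p = x then 1 else 0)) := by
  simp only [edgePush, Finsupp.add_apply, Finsupp.sub_apply, Finsupp.smul_apply,
    Finsupp.single_apply, smul_eq_mul]

/-- Pushing the weight of `p` to the ends of the edge turns coordinates in the subdivision into
coordinates in `K`. The last claim shows that the weight of `p` can be recovered, so that the push
is injective on the weights considered. -/
theorem edgePush_spec (hab : {a, b} ∈ K.faces) (hne : a ≠ b) (h0 : 0 < l) (h1 : l < 1)
    {s : Finset (EuclideanSpace ℝ (Fin N))}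
    (hs : s ∈ K.splitFaces a b (AffineMap.lineMap a b l))
    {w : EuclideanSpace ℝ (Fin N) →₀ ℝ} (hw : 0 ≤ w) (hws : w.support ⊆ s) :
    (∃ t ∈ K.faces, (edgePush a b (AffineMap.lineMap a b l) l w).support ⊆ t) ∧
    0 ≤ edgePush a b (AffineMap.lineMap a b l) l w ∧
    w (AffineMap.lineMap a b l) = min
      (edgePush a b (AffineMap.lineMap a b l) l w a / (1 - l))
      (edgePush a b (AffineMap.lineMap a b l) l w b / l) := by
  have hpv := K.lineMap_notMem_verts hab hne h0 h1
  set p : EuclideanSpace ℝ (Fin N) := AffineMap.lineMap a b l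
  have hpa : p ≠ a := fun h => hpv (h ▸ K.subset_verts hab (by simp))
  have hpb : p ≠ b := fun h => hpv (h ▸ K.subset_verts hab (by simp))
  have hl : 0 < 1 - l := by linarith
  refine ⟨?_, ?_, ?_⟩
  · obtain ⟨-, ⟨hp, hsK⟩ | ⟨hp, hsK⟩⟩ := hs
    · refine ⟨s, hsK, ?_⟩
      have : w p = 0 := Finsupp.notMem_support_iff.1 fun h => hp (hws h)
      rwa [edgePush, this, zero_smul, add_zero]
    · refine ⟨_, hsK, fun x hx => ?_⟩
      rw [Finsupp.mem_support_iff, edgePush_apply] at hx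
      simp only [Finset.mem_insert, Finset.mem_erase]
      by_contra! hcon
      obtain ⟨hxa, hxb, hxp⟩ := hcon
      by_cases hxp' : x = p
      · subst hxp'
        simp [hpa.symm, hpb.symm] at hx
      · have : w x = 0 := Finsupp.notMem_support_iff.1 fun h => hxp hxp' (hws h)
        simp [this, Ne.symm hxa, Ne.symm hxb, Ne.symm hxp'] at hx
  · intro x
    rw [edgePush_apply]
    have hx := hw x
    have hp := hw p
    simp only [Finsupp.coe_zero, Pi.zero_apply] at hx hp ⊢
    by_cases hxp : p = x
    · subst hxp
      simp [hpa.symm, hpb.symm]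
    · rw [if_neg hxp, sub_zero]
      refine add_nonneg hx (mul_nonneg hp (add_nonneg ?_ ?_)) <;> split_ifs <;> linarith
  · rw [edgePush_apply, edgePush_apply]
    simp only [hne, hne.symm, hpa, hpb, if_true, if_false, add_zero, sub_zero, zero_add]
    have ha := hw a
    have hb := hw b
    simp only [Finsupp.coe_zero, Pi.zero_apply] at ha hb
    have e1 : (w a + w p * (1 - l)) / (1 - l) = w a / (1 - l) + w p := by field_simp
    have e2 : (w b + w p * l) / l = w b / l + w p := by field_simp
    rw [e1, e2]
    -- A simplex of the subdivision does not contain both ends, so one of the two quotients equals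
    -- `w p` and the other is at least `w p`.
    have h3 : w a = 0 ∨ w b = 0 := by
      by_contra! hcon
      exact hs.1 ⟨hws (Finsupp.mem_support_iff.2 hcon.1), hws (Finsupp.mem_support_iff.2 hcon.2)⟩
    rcases h3 with h3 | h3
    · rw [h3, zero_div, zero_add, min_eq_left]
      have := div_nonneg hb h0.le
      linarith
    · rw [h3, zero_div, zero_add, min_eq_right]
      have := div_nonneg ha hl.le
      linarith

/-- Uniqueness is inherited from `K`: the pushed weights agree, then the weights at `p` agree by the
minimum formula, and then the original weights agree. -/
theorem uniqueBary_splitFaces (hab : {a, b} ∈ K.faces) (hne : a ≠ b) (h0 : 0 < l) (h1 : l < 1) :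
    UniqueBary (K.splitFaces a b (AffineMap.lineMap a b l)) := by
  intro s hs t ht w w' hw hw' hws hwt h
  obtain ⟨⟨s', hs', hss⟩, n, e⟩ := edgePush_spec hab hne h0 h1 hs hw hws
  obtain ⟨⟨t', ht', hts⟩, n', e'⟩ := edgePush_spec hab hne h0 h1 ht hw' hwt
  have hp := K.uniqueBary _ hs' _ ht' _ _ n n' hss hts
    (by rw [bary_edgePush, bary_edgePush, h])
  rw [hp, ← e'] at e
  rw [edgePush, edgePush, e] at hp
  exact add_right_cancel hp

/-- The complex that results from `K` when the edge `⟨a, b⟩` is subdivided at the point that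
divides it in the ratio `l : 1 - l`. -/
noncomputable def splitEdge (K : Complex2 N) (a b : EuclideanSpace ℝ (Fin N)) (l : ℝ)
    (hab : {a, b} ∈ K.faces) (hne : a ≠ b) (h0 : 0 < l) (h1 : l < 1) : Complex2 N :=
  ofUniqueBary (K.splitFaces a b (AffineMap.lineMap a b l))
    (by
      refine Set.Finite.subset
        (Finset.finite_toSet (insert (AffineMap.lineMap a b l) K.verts).powerset) ?_
      rintro s ⟨-, ⟨-, hs⟩ | ⟨-, hs⟩⟩
      · exact Finset.mem_coe.2 (Finset.mem_powerset.2
          ((K.subset_verts hs).trans (Finset.subset_insert _ _)))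
      · refine Finset.mem_coe.2 (Finset.mem_powerset.2 fun x hx => ?_)
        by_cases hxp : x = AffineMap.lineMap a b l
        · exact hxp ▸ Finset.mem_insert_self _ _
        · exact Finset.mem_insert_of_mem (K.subset_verts hs (by simp [hxp, hx])))
    (by
      rintro s ⟨-, ⟨-, hs⟩ | ⟨hp, -⟩⟩
      · exact K.nonempty_of_mem_faces hs
      · exact ⟨_, hp⟩)
    (by
      rintro s ⟨hn, hs⟩ t hts ht
      refine ⟨fun h => hn ⟨hts h.1, hts h.2⟩, ?_⟩
      by_cases hpt : AffineMap.lineMap a b l ∈ t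
      · obtain ⟨hp, -⟩ | ⟨-, hs⟩ := hs
        · exact absurd (hts hpt) hp
        · exact Or.inr ⟨hpt, K.down_closed hs (Finset.insert_subset_insert _
            (Finset.insert_subset_insert _ (Finset.erase_subset_erase _ hts)))
            (Finset.insert_nonempty _ _)⟩
      · refine Or.inl ⟨hpt, ?_⟩
        obtain ⟨-, hs⟩ | ⟨-, hs⟩ := hs
        · exact K.down_closed hs hts ht
        · refine K.down_closed hs (fun x hx => ?_) ht
          have : x ≠ AffineMap.lineMap a b l := fun h => hpt (h ▸ hx)
          simp [this, hts hx])
    (uniqueBary_splitFaces hab hne h0 h1)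
    (by
      rintro s ⟨hn, ⟨-, hs⟩ | ⟨hp, hs⟩⟩
      · exact K.card_le_three _ hs
      · have h3 := K.card_le_three _ hs
        -- Since `s` misses `a` or `b`, the simplex of `K` is strictly larger than `s` without `p`,
        -- which leaves room for `p`.
        have hlt : (s.erase (AffineMap.lineMap a b l)).card <
            (insert a (insert b (s.erase (AffineMap.lineMap a b l)))).card := by
          refine Finset.card_lt_card ⟨?_, fun h => hn ⟨?_, ?_⟩⟩
          · exact (Finset.subset_insert _ _).trans (Finset.subset_insert _ _)
          · exact Finset.mem_of_mem_erase (h (by simp))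
          · exact Finset.mem_of_mem_erase (h (by simp))
        have := Finset.card_erase_of_mem hp
        omega)

variable (hab : {a, b} ∈ K.faces) (hne : a ≠ b) (h0 : 0 < l) (h1 : l < 1)

theorem exists_face_of_splitFaces {s : Finset (EuclideanSpace ℝ (Fin N))}
    (hs : s ∈ K.splitFaces a b (AffineMap.lineMap a b l)) (h0 : 0 < l) (h1 : l < 1) :
    ∃ t ∈ K.faces, convexHull ℝ (s : Set (EuclideanSpace ℝ (Fin N))) ⊆
      convexHull ℝ (t : Set (EuclideanSpace ℝ (Fin N))) := by
  obtain ⟨-, ⟨-, hs⟩ | ⟨-, hs⟩⟩ := hs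
  · exact ⟨s, hs, subset_rfl⟩
  · refine ⟨_, hs, convexHull_min (fun x hx => ?_) (convex_convexHull ℝ _)⟩
    by_cases hxp : x = AffineMap.lineMap a b l
    · rw [hxp]
      refine (convex_convexHull ℝ _).lineMap_mem (subset_convexHull ℝ _ ?_)
        (subset_convexHull ℝ _ ?_) ⟨h0.le, h1.le⟩ <;> simp
    · refine subset_convexHull ℝ _ ?_
      simp only [Finset.mem_coe] at hx
      simp [hxp, hx]

/-- The nontrivial inclusion inverts `edgePush`: as much weight as possible is taken from `a` and
`b` in the ratio `1 - l : l` and placed on `p`. -/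
theorem splitEdge_isSubdivision : (K.splitEdge a b l hab hne h0 h1).IsSubdivision K := by
  refine ⟨Set.Subset.antisymm ?_ ?_, fun s hs => exists_face_of_splitFaces hs h0 h1⟩
  · intro x hx
    obtain ⟨s, hs, hx⟩ := Geometry.SimplicialComplex.mem_space_iff.1 hx
    obtain ⟨t, ht, hst⟩ := exists_face_of_splitFaces hs h0 h1
    exact Geometry.SimplicialComplex.mem_space_iff.2 ⟨t, ht, hst hx⟩
  · intro x hx
    obtain ⟨s, hs, hx⟩ := Geometry.SimplicialComplex.mem_space_iff.1 hx
    obtain ⟨w, hw, hws, hwx⟩ := mem_convexHull_iff_bary.1 hx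
    have hpv := K.lineMap_notMem_verts hab hne h0 h1
    have hpush := bary_edgePush a b l
    rw [Geometry.SimplicialComplex.mem_space_iff]
    change ∃ t ∈ K.splitFaces a b (AffineMap.lineMap a b l), _
    set p : EuclideanSpace ℝ (Fin N) := AffineMap.lineMap a b l
    have hpa : p ≠ a := fun h => hpv (h ▸ K.subset_verts hab (by simp))
    have hpb : p ≠ b := fun h => hpv (h ▸ K.subset_verts hab (by simp))
    have hps : p ∉ s := fun h => hpv (K.subset_verts hs h)
    have hwp : w p = 0 := Finsupp.notMem_support_iff.1 fun h => hps (hws h)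
    have hl : 0 < 1 - l := by linarith
    have hwa : 0 ≤ w a := hw a
    have hwb : 0 ≤ w b := hw b
    -- The largest multiple that keeps the weights of `a` and `b` nonnegative; at least one of these
    -- weights becomes 0.
    set m := min (w a / (1 - l)) (w b / l) with hm
    have hm0 : 0 ≤ m := le_min (div_nonneg hwa hl.le) (div_nonneg hwb h0.le)
    have hma : m * (1 - l) ≤ w a := (le_div_iff₀ hl).1 (min_le_left _ _)
    have hmb : m * l ≤ w b := (le_div_iff₀ h0).1 (min_le_right _ _)
    set u : EuclideanSpace ℝ (Fin N) →₀ ℝ :=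
      w - m • (Finsupp.single a (1 - l) + Finsupp.single b l - Finsupp.single p 1) with hu
    have hux : ∀ x, u x = w x - m * ((if a = x then 1 - l else 0) + (if b = x then l else 0) -
      (if p = x then 1 else 0)) := fun x => by
        simp only [hu, Finsupp.add_apply, Finsupp.sub_apply, Finsupp.smul_apply,
          Finsupp.single_apply, smul_eq_mul]
    have hua : u a = w a - m * (1 - l) := by simp [hux, hne.symm, hpa]
    have hub : u b = w b - m * l := by simp [hux, hne, hpb]
    have hup : u p = m := by simp [hux, hpa.symm, hpb.symm, hwp]
    have huo : ∀ x, x ≠ a → x ≠ b → x ≠ p → u x = w x := fun x h1 h2 h3 => by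
      simp [hux, h1.symm, h2.symm, h3.symm]
    have hu0 : 0 ≤ u := by
      intro x
      change 0 ≤ u x
      by_cases hxa : x = a
      · rw [hxa, hua]; linarith
      by_cases hxb : x = b
      · rw [hxb, hub]; linarith
      by_cases hxp : x = p
      · rw [hxp, hup]; exact hm0
      rw [huo x hxa hxb hxp]
      exact hw x
    have hbu : bary _ u = (1, x) := by
      have e : edgePush a b p l u = w := by
        rw [edgePush, hup, hu, sub_add_cancel]
      rw [← hpush u, e, hwx]
    have hune : u.support.Nonempty := by
      rw [Finset.nonempty_iff_ne_empty, Ne, Finsupp.support_eq_empty]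
      intro h
      rw [h, map_zero] at hbu
      exact zero_ne_one (congrArg Prod.fst hbu)
    refine ⟨u.support, ⟨?_, ?_⟩, mem_convexHull_iff_bary.2 ⟨u, hu0, subset_rfl, hbu⟩⟩
    · simp only [Finsupp.mem_support_iff, hua, hub]
      rintro ⟨h2, h3⟩
      rcases min_choice (w a / (1 - l)) (w b / l) with h | h
      · apply h2
        rw [hm, h]
        field_simp
        ring
      · apply h3
        rw [hm, h]
        field_simp
        ring
    -- If `m = 0`, nothing has changed. If `m > 0`, both `a` and `b` belong to `s`, so adding them
    -- to the support without `p` stays within `s`.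
    · rcases hm0.eq_or_lt with hmz | hmp
      · have huw : u = w := by rw [hu, ← hmz, zero_smul, sub_zero]
        refine Or.inl ⟨?_, K.down_closed hs (huw ▸ hws) hune⟩
        rw [Finsupp.mem_support_iff, hup]
        exact fun h => h hmz.symm
      · have ha : 0 < w a := lt_of_lt_of_le (mul_pos hmp hl) hma
        have hb : 0 < w b := lt_of_lt_of_le (mul_pos hmp h0) hmb
        refine Or.inr ⟨?_, K.down_closed hs ?_ (Finset.insert_nonempty _ _)⟩
        · rw [Finsupp.mem_support_iff, hup]
          exact hmp.ne'
        · intro y hy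
          simp only [Finset.mem_insert, Finset.mem_erase, Finsupp.mem_support_iff] at hy
          by_cases hya : y = a
          · exact hya ▸ hws (Finsupp.mem_support_iff.2 ha.ne')
          by_cases hyb : y = b
          · exact hyb ▸ hws (Finsupp.mem_support_iff.2 hb.ne')
          obtain h | h | ⟨hyp, hy⟩ := hy
          · exact absurd h hya
          · exact absurd h hyb
          · rw [huo y hya hyb hyp] at hy
            exact hws (Finsupp.mem_support_iff.2 hy)

end Split

end Complex2

/-! ### Simplicial isomorphisms and cones -/

namespace Complex2

variable {N M P : ℕ}

theorem ext_faces {K L : Complex2 N} (h : K.faces = L.faces) : K = L := by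
  obtain ⟨⟨⟨F, _⟩, _, _⟩, _, _⟩ := K
  obtain ⟨⟨⟨G, _⟩, _, _⟩, _, _⟩ := L
  obtain rfl : F = G := h
  rfl

/-- `K` is a cone with apex `w`. -/
def IsCone (K : Complex2 N) (w : EuclideanSpace ℝ (Fin N)) : Prop :=
  w ∈ K.verts ∧ ∀ s ∈ K.faces, insert w s ∈ K.faces

theorem closedStar_isCone {K : Complex2 N} {v : EuclideanSpace ℝ (Fin N)} (hv : v ∈ K.verts) :
    (K.closedStar v).IsCone v := by
  constructor
  · rw [mem_verts] at hv ⊢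
    exact ⟨hv, by simpa using hv⟩
  · rintro s ⟨-, hs⟩
    exact ⟨hs, by simpa using hs⟩

theorem IsCone.closedStar_eq {K : Complex2 N} {w : EuclideanSpace ℝ (Fin N)} (h : K.IsCone w) :
    K.closedStar w = K :=
  ext_faces (Set.Subset.antisymm (fun _ hs => hs.1) fun s hs => ⟨hs, h.2 s hs⟩)

theorem IsSimplicialIso.image_mem {K : Complex2 N} {L : Complex2 M}
    {g : EuclideanSpace ℝ (Fin N) → EuclideanSpace ℝ (Fin M)} (h : K.IsSimplicialIso L g)
    {s : Finset (EuclideanSpace ℝ (Fin N))} (hs : s ∈ K.faces) : s.image g ∈ L.faces :=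
  (h.2 s (K.subset_verts hs)).1 hs

theorem IsSimplicialIso.exists_image_eq {K : Complex2 N} {L : Complex2 M}
    {g : EuclideanSpace ℝ (Fin N) → EuclideanSpace ℝ (Fin M)} (h : K.IsSimplicialIso L g)
    {t : Finset (EuclideanSpace ℝ (Fin M))} (ht : t ∈ L.faces) :
    ∃ s ∈ K.faces, s.image g = t := by
  classical
  have himg : (K.verts.filter fun x => g x ∈ t).image g = t := by
    ext y
    simp only [Finset.mem_image, Finset.mem_filter]
    constructor
    · rintro ⟨x, ⟨-, hx⟩, rfl⟩
      exact hx
    · intro hy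
      obtain ⟨x, hx, rfl⟩ := h.1.surjOn (Finset.mem_coe.2 (L.subset_verts ht hy))
      exact ⟨x, ⟨hx, hy⟩, rfl⟩
  refine ⟨K.verts.filter fun x => g x ∈ t, (h.2 _ (Finset.filter_subset _ _)).2 ?_, himg⟩
  rwa [himg]

/-- Injectivity on the vertices lets a simplex be recovered from its image, so it suffices to map
simplices onto simplices. -/
theorem isSimplicialIso_of_image {K : Complex2 N} {L : Complex2 M}
    {g : EuclideanSpace ℝ (Fin N) → EuclideanSpace ℝ (Fin M)} (hinj : Set.InjOn g K.verts)
    (hmem : ∀ s ∈ K.faces, s.image g ∈ L.faces)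
    (hex : ∀ t ∈ L.faces, ∃ s ∈ K.faces, s.image g = t) : K.IsSimplicialIso L g := by
  classical
  refine ⟨⟨fun x hx => ?_, hinj, fun y hy => ?_⟩, fun s hs => ⟨hmem s, fun h => ?_⟩⟩
  · have hx' := (K.mem_verts x).1 hx
    exact (L.mem_verts _).2 (by simpa using hmem _ hx')
  · obtain ⟨s, hs, hsy⟩ := hex _ ((L.mem_verts y).1 hy)
    have : y ∈ s.image g := by rw [hsy]; simp
    obtain ⟨x, hx, rfl⟩ := Finset.mem_image.1 this
    exact ⟨x, K.subset_verts hs hx, rfl⟩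
  · obtain ⟨s', hs', he⟩ := hex _ h
    have : s' = s := by
      ext x
      constructor <;> intro hx
      · obtain ⟨y, hy, hxy⟩ := Finset.mem_image.1 (he ▸ Finset.mem_image_of_mem g hx)
        rwa [← hinj (hs hy) (K.subset_verts hs' hx) hxy]
      · obtain ⟨y, hy, hxy⟩ := Finset.mem_image.1 (he.symm ▸ Finset.mem_image_of_mem g hx)
        rwa [← hinj (K.subset_verts hs' hy) (hs hx) hxy]
    exact this ▸ hs'

theorem isSimplicialIso_id (K : Complex2 N) : K.IsSimplicialIso K id :=
  isSimplicialIso_of_image (Set.injOn_id _) (fun s hs => by simpa using hs)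
    fun t ht => ⟨t, ht, by simp⟩

theorem IsSimplicialIso.congr {K : Complex2 N} {L : Complex2 M}
    {g h : EuclideanSpace ℝ (Fin N) → EuclideanSpace ℝ (Fin M)} (hg : K.IsSimplicialIso L g)
    (he : ∀ x ∈ K.verts, g x = h x) : K.IsSimplicialIso L h := by
  refine ⟨hg.1.congr fun x hx => he x hx, fun s hs => ?_⟩
  rw [hg.2 s hs, Finset.image_congr fun x hx => he x (hs hx)]

theorem IsSimplicialIso.comp {K : Complex2 N} {L : Complex2 M} {R : Complex2 P}
    {g : EuclideanSpace ℝ (Fin N) → EuclideanSpace ℝ (Fin M)}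
    {h : EuclideanSpace ℝ (Fin M) → EuclideanSpace ℝ (Fin P)} (hh : L.IsSimplicialIso R h)
    (hg : K.IsSimplicialIso L g) : K.IsSimplicialIso R (h ∘ g) := by
  classical
  refine isSimplicialIso_of_image (hh.1.comp hg.1).injOn (fun s hs => ?_) fun t ht => ?_
  · rw [← Finset.image_image]
    exact hh.image_mem (hg.image_mem hs)
  · obtain ⟨r, hr, rfl⟩ := hh.exists_image_eq ht
    obtain ⟨s, hs, rfl⟩ := hg.exists_image_eq hr
    exact ⟨s, hs, Finset.image_image.symm⟩

theorem IsSimplicialIso.exists_inverse {K : Complex2 N} {L : Complex2 M}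
    {g : EuclideanSpace ℝ (Fin N) → EuclideanSpace ℝ (Fin M)} (hg : K.IsSimplicialIso L g) :
    ∃ h, L.IsSimplicialIso K h ∧ ∀ x ∈ K.verts, h (g x) = x := by
  classical
  have hinv : ∀ x ∈ K.verts, Function.invFunOn g K.verts (g x) = x := fun x hx =>
    hg.1.injOn.leftInvOn_invFunOn hx
  have himg : ∀ s ∈ K.faces, (s.image g).image (Function.invFunOn g K.verts) = s := by
    intro s hs
    rw [Finset.image_image]
    conv_rhs => rw [← Finset.image_id (s := s)]
    exact Finset.image_congr fun x hx => hinv x (K.subset_verts hs hx)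
  refine ⟨Function.invFunOn g K.verts, isSimplicialIso_of_image ?_ ?_ ?_, hinv⟩
  · intro x hx y hy h
    obtain ⟨x, hx', rfl⟩ := hg.1.surjOn hx
    obtain ⟨y, hy', rfl⟩ := hg.1.surjOn hy
    rw [hinv x hx', hinv y hy'] at h
    rw [h]
  · intro t ht
    obtain ⟨s, hs, rfl⟩ := hg.exists_image_eq ht
    rwa [himg s hs]
  · exact fun s hs => ⟨_, hg.image_mem hs, himg s hs⟩

theorem IsSimplicialIso.isCone {K : Complex2 N} {L : Complex2 M}
    {g : EuclideanSpace ℝ (Fin N) → EuclideanSpace ℝ (Fin M)} (hg : K.IsSimplicialIso L g)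
    {w : EuclideanSpace ℝ (Fin N)} (h : K.IsCone w) : L.IsCone (g w) := by
  classical
  refine ⟨hg.1.mapsTo h.1, fun t ht => ?_⟩
  obtain ⟨s, hs, rfl⟩ := hg.exists_image_eq ht
  rw [← Finset.image_insert]
  exact hg.image_mem (h.2 s hs)

theorem IsCone.starsIsometric {K : Complex2 N} {L : Complex2 M}
    {w : EuclideanSpace ℝ (Fin N)} {w' : EuclideanSpace ℝ (Fin M)} (hK : K.IsCone w)
    (hL : L.IsCone w') {g : EuclideanSpace ℝ (Fin N) → EuclideanSpace ℝ (Fin M)}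
    (hg : K.IsSimplicialIsometry L g) (hw : g w = w') : K.StarsIsometric w L w' :=
  ⟨g, by rwa [hK.closedStar_eq, hL.closedStar_eq], hw⟩

theorem IsCone.edge_mem {K : Complex2 N} {w b : EuclideanSpace ℝ (Fin N)} (h : K.IsCone w)
    (hb : b ∈ K.verts) : {w, b} ∈ K.faces := h.2 _ ((K.mem_verts b).1 hb)

/-- Subdividing an edge at the apex of a cone, and taking the star of the apex, replaces one
vertex. -/
theorem IsCone.isSimplicialIso_closedStar_splitEdge {K : Complex2 N}
    {w b : EuclideanSpace ℝ (Fin N)} (h : K.IsCone w) {l : ℝ} (hwb : {w, b} ∈ K.faces)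
    (hne : w ≠ b) (h0 : 0 < l) (h1 : l < 1) :
    K.IsSimplicialIso ((K.splitEdge w b l hwb hne h0 h1).closedStar w)
      (Function.update id b (AffineMap.lineMap w b l)) := by
  classical
  have hpv := K.lineMap_notMem_verts hwb hne h0 h1
  have hfaces : ((K.splitEdge w b l hwb hne h0 h1).closedStar w).faces =
    {s | s ∈ K.splitFaces w b (AffineMap.lineMap w b l) ∧
      insert w s ∈ K.splitFaces w b (AffineMap.lineMap w b l)} := rfl
  set p : EuclideanSpace ℝ (Fin N) := AffineMap.lineMap w b l
  have hpw : p ≠ w := fun h => hpv (h ▸ K.subset_verts hwb (by simp))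
  have hpb : p ≠ b := fun h => hpv (h ▸ K.subset_verts hwb (by simp))
  have hpK : ∀ s ∈ K.faces, p ∉ s := fun s hs hp => hpv (K.subset_verts hs hp)
  have hold : ∀ s : Finset (EuclideanSpace ℝ (Fin N)), b ∉ s →
      s.image (Function.update id b p) = s := fun s hs => by
    conv_rhs => rw [← Finset.image_id (s := s)]
    refine Finset.image_congr fun x hx => ?_
    rw [Function.update_of_ne]
    rintro rfl
    exact hs hx
  have hnew : ∀ s : Finset (EuclideanSpace ℝ (Fin N)), b ∈ s →
      s.image (Function.update id b p) = insert p (s.erase b) := fun s hs => by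
    conv_lhs => rw [← Finset.insert_erase hs]
    rw [Finset.image_insert, hold _ (Finset.notMem_erase b s), Function.update_self]
  refine isSimplicialIso_of_image ?_ ?_ ?_
  · intro x hx y hy hxy
    by_cases hxb : x = b <;> by_cases hyb : y = b
    · rw [hxb, hyb]
    · rw [hxb, Function.update_self, Function.update_of_ne hyb] at hxy
      exact absurd hy (by simpa [← show p = y from hxy] using hpv)
    · rw [hyb, Function.update_self, Function.update_of_ne hxb] at hxy
      exact absurd hx (by simpa [show x = p from hxy] using hpv)
    · rwa [Function.update_of_ne hxb, Function.update_of_ne hyb] at hxy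
  · intro s hs
    rw [hfaces]
    by_cases hb : b ∈ s
    · rw [hnew s hb]
      have hps := hpK s hs
      have e1 : (insert p (s.erase b)).erase p = s.erase b :=
        Finset.erase_insert fun h => hps (Finset.mem_of_mem_erase h)
      have e2 : (insert w (insert p (s.erase b))).erase p = insert w (s.erase b) := by
        rw [Finset.insert_comm, Finset.erase_insert]
        simp [hpw, hps]
      refine ⟨⟨by simp [hpb.symm], Or.inr ⟨by simp, ?_⟩⟩,
        ⟨by simp [hpb.symm, hne.symm], Or.inr ⟨by simp, ?_⟩⟩⟩
      · rw [e1, Finset.insert_erase hb]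
        exact h.2 s hs
      · rw [e2, Finset.insert_comm b w, Finset.insert_erase hb]
        simpa using h.2 s hs
    · rw [hold s hb]
      exact ⟨⟨fun h => hb h.2, Or.inl ⟨hpK s hs, hs⟩⟩,
        ⟨fun h => hb (by simpa [hne.symm] using h.2), Or.inl ⟨hpK _ (h.2 s hs), h.2 s hs⟩⟩⟩
  · intro t ht
    rw [hfaces] at ht
    obtain ⟨ht, ⟨hnb, -⟩⟩ := ht
    -- In the star of `w` the set `insert w t` is also a simplex, and no simplex of the subdivision
    -- contains both `w` and `b`. Thus `b` disappears and `p` takes its place.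
    have hb : b ∉ t := fun h => hnb ⟨by simp, by simp [h]⟩
    obtain ⟨-, ⟨-, htK⟩ | ⟨hp, htK⟩⟩ := ht
    · exact ⟨t, htK, hold t hb⟩
    · have e : (insert b (t.erase p)).erase b = t.erase p :=
        Finset.erase_insert fun h => hb (Finset.mem_of_mem_erase h)
      refine ⟨insert b (t.erase p), K.down_closed htK (Finset.subset_insert _ _)
        (Finset.insert_nonempty _ _), ?_⟩
      rw [hnew _ (by simp), e, Finset.insert_erase hp]

end Complex2

/-! ### Moving vertices towards the apex of a cone -/

section VertexFunctions

open Complex2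

variable {N M : ℕ} {T : ComplexClass} {φ : VertexFunction}

/-- The star of `v` is a cone from `v`, hence its own star, so the identity is an isometry of stars.
-/
theorem phi_closedStar (hstar : T.StarClosed) (hI : φ.InvariantUnderStarIsometries T)
    {K : Complex2 N} (hK : K ∈ T N) {v : EuclideanSpace ℝ (Fin N)} (hv : v ∈ K.verts) :
    φ N (K.closedStar v) v = φ N K v := by
  have hc := closedStar_isCone hv
  refine hI N N _ (hstar N K hK v hv) K hK v hc.1 v hv ⟨id, ⟨?_, fun _ _ _ => rfl⟩, rfl⟩
  rw [hc.closedStar_eq]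
  exact isSimplicialIso_id _

theorem phi_eq_of_isometry (hI : φ.InvariantUnderStarIsometries T)
    {K : Complex2 N} (hK : K ∈ T N) {L : Complex2 M} (hL : L ∈ T M)
    {w : EuclideanSpace ℝ (Fin N)} {w' : EuclideanSpace ℝ (Fin M)} (hKw : K.IsCone w)
    (hLw : L.IsCone w') {g : EuclideanSpace ℝ (Fin N) → EuclideanSpace ℝ (Fin M)}
    (hg : K.IsSimplicialIsometry L g) (hw : g w = w') : φ N K w = φ M L w' :=
  hI N M K hK L hL w hKw.1 w' hLw.1 (hKw.starsIsometric hLw hg hw)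

/-- One step of the rescaling: subdivide the edge `⟨w, b⟩` and take the star of `w`. Subdivision
invariance and invariance under isometries of stars keep the value at `w`. -/
theorem exists_replace_vertex (hstar : T.StarClosed) (hsub : T.SubdivisionClosed)
    (hI : φ.InvariantUnderStarIsometries T) (hS : φ.InvariantUnderSubdivision T)
    {K : Complex2 N} (hK : K ∈ T N) {w b : EuclideanSpace ℝ (Fin N)} (hKw : K.IsCone w)
    (hwb : {w, b} ∈ K.faces) (hne : w ≠ b) {l : ℝ} (h0 : 0 < l) (h1 : l < 1) :
    ∃ K' ∈ T N, K.IsSimplicialIso K' (Function.update id b (AffineMap.lineMap w b l)) ∧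
      φ N K' w = φ N K w := by
  have hsd := splitEdge_isSubdivision hwb hne h0 h1
  have hJ := hsub N K hK _ hsd
  have hiso := hKw.isSimplicialIso_closedStar_splitEdge hwb hne h0 h1
  have hw : w ∈ (K.splitEdge w b l hwb hne h0 h1).verts := by
    have h2 : w ∈ ((K.splitEdge w b l hwb hne h0 h1).closedStar w).verts := by
      have := hiso.1.mapsTo hKw.1
      rwa [Function.update_of_ne hne] at this
    rw [mem_verts] at h2 ⊢
    exact h2.1
  refine ⟨_, hstar N _ hJ w hw, hiso, ?_⟩
  rw [phi_closedStar hstar hI hJ hw, hS N K hK _ hJ w hKw.1 hsd]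

open Classical in
/-- Move the points of `B` towards `w`. -/
noncomputable def shrinkMap (w : EuclideanSpace ℝ (Fin N)) (B : Finset (EuclideanSpace ℝ (Fin N)))
    (t : EuclideanSpace ℝ (Fin N) → ℝ) (x : EuclideanSpace ℝ (Fin N)) : EuclideanSpace ℝ (Fin N) :=
  if x ∈ B then AffineMap.lineMap w x (t x) else x

theorem shrinkMap_of_mem {w x : EuclideanSpace ℝ (Fin N)} {B : Finset (EuclideanSpace ℝ (Fin N))}
    {t : EuclideanSpace ℝ (Fin N) → ℝ} (h : x ∈ B) :
    shrinkMap w B t x = AffineMap.lineMap w x (t x) := if_pos h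

theorem shrinkMap_of_notMem {w x : EuclideanSpace ℝ (Fin N)}
    {B : Finset (EuclideanSpace ℝ (Fin N))}
    {t : EuclideanSpace ℝ (Fin N) → ℝ} (h : x ∉ B) : shrinkMap w B t x = x := if_neg h

/-- In a cone the vertices other than the apex can be moved towards the apex without changing the
value at the apex. -/
theorem exists_shrink (hstar : T.StarClosed) (hsub : T.SubdivisionClosed)
    (hI : φ.InvariantUnderStarIsometries T) (hS : φ.InvariantUnderSubdivision T)
    {K : Complex2 N} (hK : K ∈ T N) {w : EuclideanSpace ℝ (Fin N)} (hKw : K.IsCone w)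
    (B : Finset (EuclideanSpace ℝ (Fin N))) (hB : B ⊆ K.verts) (hwB : w ∉ B)
    (t : EuclideanSpace ℝ (Fin N) → ℝ) (h0 : ∀ x ∈ B, 0 < t x) (h1 : ∀ x ∈ B, t x < 1) :
    ∃ K' ∈ T N, K.IsSimplicialIso K' (shrinkMap w B t) ∧ φ N K' w = φ N K w := by
  classical
  induction B using Finset.induction_on with
  | empty =>
    exact ⟨K, hK, (isSimplicialIso_id K).congr fun x _ => by
      rw [shrinkMap_of_notMem (Finset.notMem_empty x), id], rfl⟩
  | insert b B hb ih =>
    have hwB' : w ∉ B := fun h => hwB (Finset.mem_insert_of_mem h)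
    have hwb : w ≠ b := fun h => hwB (h ▸ Finset.mem_insert_self _ _)
    have hbK : b ∈ K.verts := hB (Finset.mem_insert_self _ _)
    obtain ⟨K', hK', hiso, hφ⟩ := ih ((Finset.subset_insert _ _).trans hB) hwB'
      (fun x hx => h0 x (Finset.mem_insert_of_mem hx))
      (fun x hx => h1 x (Finset.mem_insert_of_mem hx))
    have hw' : shrinkMap w B t w = w := shrinkMap_of_notMem hwB'
    have hb' : shrinkMap w B t b = b := shrinkMap_of_notMem hb
    have hcone : K'.IsCone w := hw' ▸ hiso.isCone hKw
    have hedge : {w, b} ∈ K'.faces := hcone.edge_mem (hb' ▸ hiso.1.mapsTo hbK)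
    obtain ⟨K'', hK'', hiso', hφ'⟩ := exists_replace_vertex hstar hsub hI hS hK' hcone hedge hwb
      (h0 b (Finset.mem_insert_self _ _)) (h1 b (Finset.mem_insert_self _ _))
    refine ⟨K'', hK'', (hiso'.comp hiso).congr fun x hx => ?_, hφ'.trans hφ⟩
    by_cases hxb : x = b
    · rw [hxb, Function.comp_apply, hb', Function.update_self,
        shrinkMap_of_mem (Finset.mem_insert_self _ _)]
    · have hne : shrinkMap w B t x ≠ b := fun h =>
        hxb (hiso.1.injOn hx hbK (h.trans hb'.symm))
      rw [Function.comp_apply, Function.update_of_ne hne, id]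
      simp [shrinkMap, hxb]

theorem angle_lineMap_lineMap {w a b : EuclideanSpace ℝ (Fin N)} {r s : ℝ} (hr : 0 < r)
    (hs : 0 < s) : EuclideanGeometry.angle (AffineMap.lineMap w a r) w (AffineMap.lineMap w b s) =
      EuclideanGeometry.angle a w b := by
  rw [EuclideanGeometry.angle, EuclideanGeometry.angle, AffineMap.lineMap_vsub_left,
    AffineMap.lineMap_vsub_left, InnerProductGeometry.angle_smul_left_of_pos _ _ hr,
    InnerProductGeometry.angle_smul_right_of_pos _ _ hs]

theorem angle_shrinkMap {w a b : EuclideanSpace ℝ (Fin N)}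
    {B : Finset (EuclideanSpace ℝ (Fin N))} {t : EuclideanSpace ℝ (Fin N) → ℝ}
    (h0 : ∀ x ∈ B, 0 < t x) :
    EuclideanGeometry.angle (shrinkMap w B t a) w (shrinkMap w B t b) =
      EuclideanGeometry.angle a w b := by
  have key : ∀ x, ∃ r : ℝ, 0 < r ∧ shrinkMap w B t x = AffineMap.lineMap w x r := by
    intro x
    by_cases hx : x ∈ B
    · exact ⟨t x, h0 x hx, shrinkMap_of_mem hx⟩
    · exact ⟨1, one_pos, by rw [shrinkMap_of_notMem hx, AffineMap.lineMap_apply_one]⟩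
  obtain ⟨r, hr, ha⟩ := key a
  obtain ⟨s, hs, hb⟩ := key b
  rw [ha, hb, angle_lineMap_lineMap hr hs]

/-- The value at the apex of a cone depends only on the angles at the apex. -/
theorem phi_eq_of_angles (hstar : T.StarClosed) (hsub : T.SubdivisionClosed)
    (hI : φ.InvariantUnderStarIsometries T) (hS : φ.InvariantUnderSubdivision T)
    {K : Complex2 N} (hK : K ∈ T N) {L : Complex2 M} (hL : L ∈ T M)
    {w : EuclideanSpace ℝ (Fin N)} {w' : EuclideanSpace ℝ (Fin M)} (hKw : K.IsCone w)
    {g : EuclideanSpace ℝ (Fin N) → EuclideanSpace ℝ (Fin M)}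
    (hg : K.IsSimplicialIso L g) (hw : g w = w')
    (hang : ∀ a b, {a, b} ∈ K.faces → a ≠ w → b ≠ w → a ≠ b →
      EuclideanGeometry.angle a w b = EuclideanGeometry.angle (g a) w' (g b)) :
    φ N K w = φ M L w' := by
  classical
  have hLw : L.IsCone w' := hw ▸ hg.isCone hKw
  -- A common length, shorter than every edge at either apex; rescaling makes all these edges have
  -- length `l`.
  obtain ⟨l, hl0, hlK, hlL⟩ : ∃ l : ℝ, 0 < l ∧ (∀ x ∈ K.verts.erase w, l < dist w x) ∧
      ∀ x ∈ L.verts.erase w', l < dist w' x := by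
    have h1 : ∀ᶠ l in nhdsWithin (0 : ℝ) (Set.Ioi 0), ∀ x ∈ K.verts.erase w, l < dist w x :=
      (Filter.eventually_all_finset _).2 fun x hx => nhdsWithin_le_nhds
        (eventually_lt_nhds (dist_pos.2 (Finset.ne_of_mem_erase hx).symm))
    have h2 : ∀ᶠ l in nhdsWithin (0 : ℝ) (Set.Ioi 0), ∀ x ∈ L.verts.erase w', l < dist w' x :=
      (Filter.eventually_all_finset _).2 fun x hx => nhdsWithin_le_nhds
        (eventually_lt_nhds (dist_pos.2 (Finset.ne_of_mem_erase hx).symm))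
    have h3 : ∀ᶠ l in nhdsWithin (0 : ℝ) (Set.Ioi 0), 0 < l := self_mem_nhdsWithin
    obtain ⟨l, hl0, hl⟩ := (h3.and (h1.and h2)).exists
    exact ⟨l, hl0, hl⟩
  have hdist : ∀ {n : ℕ} (u x : EuclideanSpace ℝ (Fin n)), l < dist u x →
      dist (AffineMap.lineMap u x (l / dist u x)) u = l := by
    intro n u x hx
    rw [dist_lineMap_left, Real.norm_of_nonneg (div_nonneg hl0.le dist_nonneg),
      div_mul_cancel₀ _ (hl0.trans hx).ne']
  have hpos : ∀ {n : ℕ} {R : Complex2 n} {u : EuclideanSpace ℝ (Fin n)},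
      (∀ x ∈ R.verts.erase u, l < dist u x) → ∀ x ∈ R.verts.erase u, 0 < l / dist u x :=
    fun h x hx => div_pos hl0 (hl0.trans (h x hx))
  have hlt : ∀ {n : ℕ} {R : Complex2 n} {u : EuclideanSpace ℝ (Fin n)},
      (∀ x ∈ R.verts.erase u, l < dist u x) → ∀ x ∈ R.verts.erase u, l / dist u x < 1 :=
    fun h x hx => (div_lt_one (hl0.trans (h x hx))).2 (h x hx)
  obtain ⟨K', hK', hisoK, hφK⟩ := exists_shrink hstar hsub hI hS hK hKw (K.verts.erase w)
    (Finset.erase_subset _ _) (Finset.notMem_erase _ _) (fun x => l / dist w x) (hpos hlK)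
    (hlt hlK)
  obtain ⟨L', hL', hisoL, hφL⟩ := exists_shrink hstar hsub hI hS hL hLw (L.verts.erase w')
    (Finset.erase_subset _ _) (Finset.notMem_erase _ _) (fun x => l / dist w' x) (hpos hlL)
    (hlt hlL)
  have haK : ∀ a b, EuclideanGeometry.angle (shrinkMap w (K.verts.erase w)
      (fun x => l / dist w x) a) w (shrinkMap w (K.verts.erase w) (fun x => l / dist w x) b) =
      EuclideanGeometry.angle a w b := fun a b => angle_shrinkMap (hpos hlK)
  have haL : ∀ a b, EuclideanGeometry.angle (shrinkMap w' (L.verts.erase w')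
      (fun x => l / dist w' x) a) w' (shrinkMap w' (L.verts.erase w') (fun x => l / dist w' x) b) =
      EuclideanGeometry.angle a w' b := fun a b => angle_shrinkMap (hpos hlL)
  have hdK : ∀ x ∈ K.verts.erase w, dist (shrinkMap w (K.verts.erase w)
      (fun x => l / dist w x) x) w = l := fun x hx => by
    rw [shrinkMap_of_mem hx]; exact hdist w x (hlK x hx)
  have hdL : ∀ x ∈ L.verts.erase w', dist (shrinkMap w' (L.verts.erase w')
      (fun x => l / dist w' x) x) w' = l := fun x hx => by
    rw [shrinkMap_of_mem hx]; exact hdist w' x (hlL x hx)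
  have hwK : shrinkMap w (K.verts.erase w) (fun x => l / dist w x) w = w :=
    shrinkMap_of_notMem (Finset.notMem_erase _ _)
  have hwL : shrinkMap w' (L.verts.erase w') (fun x => l / dist w' x) w' = w' :=
    shrinkMap_of_notMem (Finset.notMem_erase _ _)
  generalize shrinkMap w (K.verts.erase w) (fun x => l / dist w x) = ρ at *
  generalize shrinkMap w' (L.verts.erase w') (fun x => l / dist w' x) = ρ' at *
  -- The rescaled cones are compared by undoing the first rescaling, applying `g`, and rescaling the
  -- result.
  obtain ⟨h, hh, hhρ⟩ := hisoK.exists_inverse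
  have hhw : h w = w := by
    have := hhρ w hKw.1
    rwa [hwK] at this
  rw [← hφK, ← hφL]
  refine phi_eq_of_isometry hI hK' hL' (hwK ▸ hisoK.isCone hKw) (hwL ▸ hisoL.isCone hLw)
    (g := ρ' ∘ (g ∘ h)) ⟨hisoL.comp (hg.comp hh), ?_⟩ (by simp [hhw, hw, hwL])
  intro a' b' hab'
  obtain ⟨a, haK', rfl⟩ := hisoK.1.surjOn (K'.subset_verts hab' (show a' ∈ _ by simp))
  obtain ⟨b, hbK', rfl⟩ := hisoK.1.surjOn (K'.subset_verts hab' (show b' ∈ _ by simp))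
  have hab : {a, b} ∈ K.faces := by
    have := hh.image_mem hab'
    rwa [Finset.image_insert, Finset.image_singleton, hhρ a haK', hhρ b hbK'] at this
  simp only [Function.comp_apply, hhρ a haK', hhρ b hbK']
  have hgL : ∀ x ∈ K.verts, x ≠ w → g x ∈ L.verts.erase w' := fun x hx hxw =>
    Finset.mem_erase.2 ⟨fun h => hxw (hg.1.injOn hx hKw.1 (h.trans hw.symm)), hg.1.mapsTo hx⟩
  have hdg : ∀ x ∈ K.verts, x ≠ w → dist (ρ' (g x)) w' = l := fun x hx hxw =>
    hdL _ (hgL x hx hxw)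
  have hdk : ∀ x ∈ K.verts, x ≠ w → dist (ρ x) w = l := fun x hx hxw =>
    hdK _ (Finset.mem_erase.2 ⟨hxw, hx⟩)
  by_cases heq : a = b
  · rw [heq, dist_self, dist_self]
  by_cases haw : a = w
  · subst haw
    rw [hw, hwL, hwK, dist_comm, hdg b hbK' (Ne.symm heq), dist_comm, hdk b hbK' (Ne.symm heq)]
  by_cases hbw : b = w
  · subst hbw
    rw [hw, hwL, hwK, hdg a haK' heq, hdk a haK' heq]
  -- Edges opposite the apex: by the law of cosines their lengths are determined by `l` and the
  -- angles at the apex.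
  rw [← sq_eq_sq₀ dist_nonneg dist_nonneg, sq, sq,
    EuclideanGeometry.dist_sq_eq_dist_sq_add_dist_sq_sub_two_mul_dist_mul_dist_mul_cos_angle
      (ρ' (g a)) w' (ρ' (g b)),
    EuclideanGeometry.dist_sq_eq_dist_sq_add_dist_sq_sub_two_mul_dist_mul_dist_mul_cos_angle
      (ρ a) w (ρ b), haK, haL, hang a b hab haw hbw heq, hdg a haK' haw, hdg b hbK' hbw,
    hdk a haK' haw, hdk b hbK' hbw]

end VertexFunctions

/-! ### Triangles and flaps -/

namespace Complex2

variable {N M : ℕ} {ι : Type*}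

/-- `K` consists of the triangle with the vertices `a`, `b`, `c` and its faces. -/
structure IsTriangle (K : Complex2 N) (a b c : EuclideanSpace ℝ (Fin N)) : Prop where
  ne₁ : a ≠ b
  ne₂ : a ≠ c
  ne₃ : b ≠ c
  mem_iff : ∀ s, s ∈ K.faces ↔ s.Nonempty ∧ s ⊆ {a, b, c}

/-- `K` is a flap on the edge `⟨w, v⟩` whose triangles have the third vertices `f i`, `i ∈ I`. -/
structure IsFlapOn (K : Complex2 N) (w v : EuclideanSpace ℝ (Fin N)) (I : Finset ι)
    (f : ι → EuclideanSpace ℝ (Fin N)) : Prop where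
  ne : w ≠ v
  injOn : Set.InjOn f I
  ne_left : ∀ i ∈ I, f i ≠ w
  ne_right : ∀ i ∈ I, f i ≠ v
  mem_iff : ∀ s, s ∈ K.faces ↔ s.Nonempty ∧ (s ⊆ {w, v} ∨ ∃ i ∈ I, s ⊆ {w, v, f i})

namespace IsTriangle

variable {K : Complex2 N} {a b c : EuclideanSpace ℝ (Fin N)}

theorem rotate (h : K.IsTriangle a b c) : K.IsTriangle b c a :=
  ⟨h.ne₃, h.ne₁.symm, h.ne₂.symm, fun s => by
    rw [h.mem_iff, show ({b, c, a} : Finset (EuclideanSpace ℝ (Fin N))) = {a, b, c} by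
      ext; simp; tauto]⟩

theorem swap (h : K.IsTriangle a b c) : K.IsTriangle a c b :=
  ⟨h.ne₂, h.ne₁, h.ne₃.symm, fun s => by rw [h.mem_iff, Finset.pair_comm]⟩

theorem mem_faces (h : K.IsTriangle a b c) : {a, b, c} ∈ K.faces :=
  (h.mem_iff _).2 ⟨Finset.insert_nonempty _ _, subset_rfl⟩

theorem verts_eq (h : K.IsTriangle a b c) : K.verts = {a, b, c} := by
  ext x
  rw [mem_verts, h.mem_iff]
  simp

theorem isCone (h : K.IsTriangle a b c) : K.IsCone a := by
  refine ⟨by simp [h.verts_eq], fun s hs => ?_⟩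
  rw [h.mem_iff] at hs ⊢
  exact ⟨Finset.insert_nonempty _ _, Finset.insert_subset (by simp) hs.2⟩

theorem not_collinear (h : K.IsTriangle a b c) : ¬ Collinear ℝ {a, b, c} := by
  rw [← affineIndependent_iff_not_collinear_set]
  have hi := K.indep h.mem_faces
  let g : Fin 3 ↪ ({a, b, c} : Finset (EuclideanSpace ℝ (Fin N))) :=
    ⟨![⟨a, by simp⟩, ⟨b, by simp⟩, ⟨c, by simp⟩], by
      have := h.ne₁
      have := h.ne₂
      have := h.ne₃
      intro i j hij
      fin_cases i <;> fin_cases j <;> simp_all⟩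
  have hg : ![a, b, c] = Subtype.val ∘ g := by
    funext i
    fin_cases i <;> rfl
  rw [hg]
  exact hi.comp_embedding g

theorem isSimplicialIso {L : Complex2 M} {a' b' c' : EuclideanSpace ℝ (Fin M)}
    (h : K.IsTriangle a b c) (h' : L.IsTriangle a' b' c')
    {g : EuclideanSpace ℝ (Fin N) → EuclideanSpace ℝ (Fin M)}
    (ha : g a = a') (hb : g b = b') (hc : g c = c') : K.IsSimplicialIso L g := by
  classical
  have himg : ({a, b, c} : Finset (EuclideanSpace ℝ (Fin N))).image g = {a', b', c'} := by
    simp [Finset.image_insert, ha, hb, hc]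
  have h1 := h'.ne₁
  have h2 := h'.ne₂
  have h3 := h'.ne₃
  have hinj : Set.InjOn g K.verts := by
    rw [h.verts_eq]
    intro x hx y hy hxy
    simp only [Finset.coe_insert, Finset.coe_singleton, Set.mem_insert_iff,
      Set.mem_singleton_iff] at hx hy
    subst ha hb hc
    grind
  refine isSimplicialIso_of_image hinj (fun s hs => ?_) fun t ht => ?_
  · rw [h.mem_iff] at hs
    exact (h'.mem_iff _).2 ⟨hs.1.image g, himg ▸ Finset.image_subset_image hs.2⟩
  · obtain ⟨htne, hts⟩ := (h'.mem_iff _).1 ht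
    rw [← himg, Finset.subset_image_iff] at hts
    obtain ⟨s, hs, rfl⟩ := hts
    exact ⟨s, (h.mem_iff _).2 ⟨Finset.image_nonempty.1 htne, by exact_mod_cast hs⟩, rfl⟩

end IsTriangle

theorem exists_isTriangle {a b c : EuclideanSpace ℝ (Fin N)} (h : ¬ Collinear ℝ {a, b, c}) :
    ∃ K : Complex2 N, K.IsTriangle a b c := by
  have h1 : a ≠ b := by
    rintro rfl
    exact h (by simpa using collinear_pair ℝ a c)
  have h2 : a ≠ c := by
    rintro rfl
    exact h (by simpa [Set.insert_comm] using collinear_pair ℝ b a)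
  have h3 : b ≠ c := by
    rintro rfl
    exact h (by simpa using collinear_pair ℝ a b)
  rw [← affineIndependent_iff_not_collinear_set] at h
  have hi : AffineIndependent ℝ
      ((↑) : ({a, b, c} : Finset (EuclideanSpace ℝ (Fin N))) → EuclideanSpace ℝ (Fin N)) := by
    have hr := h.range
    have e : Set.range ![a, b, c] =
        (({a, b, c} : Finset (EuclideanSpace ℝ (Fin N))) : Set (EuclideanSpace ℝ (Fin N))) := by
      ext x
      simp [or_comm, or_left_comm, eq_comm]
    rw [e] at hr
    exact hr
  refine ⟨ofUniqueBary {s | s.Nonempty ∧ s ⊆ {a, b, c}} ?_ (fun s hs => hs.1)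
    (fun s hs t hts ht => ⟨ht, hts.trans hs.2⟩)
    (uniqueBary_of_affineIndependent hi fun t ht => ht.2)
    (fun s hs => (Finset.card_le_card hs.2).trans Finset.card_le_three),
    h1, h2, h3, fun s => Iff.rfl⟩
  exact (Finset.finite_toSet ({a, b, c} : Finset (EuclideanSpace ℝ (Fin N))).powerset).subset
    fun s hs => Finset.mem_coe.2 (Finset.mem_powerset.2 hs.2)

namespace IsFlapOn

variable {K : Complex2 N} {w v : EuclideanSpace ℝ (Fin N)} {I : Finset ι}
  {f : ι → EuclideanSpace ℝ (Fin N)}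

theorem symm (h : K.IsFlapOn w v I f) : K.IsFlapOn v w I f :=
  ⟨h.ne.symm, h.injOn, h.ne_right, h.ne_left, fun s => by
    simp only [h.mem_iff, Finset.pair_comm v w, Finset.insert_comm v w]⟩

theorem edge_mem (h : K.IsFlapOn w v I f) : {w, v} ∈ K.faces :=
  (h.mem_iff _).2 ⟨Finset.insert_nonempty _ _, Or.inl subset_rfl⟩

theorem triangle_mem (h : K.IsFlapOn w v I f) {i : ι} (hi : i ∈ I) : {w, v, f i} ∈ K.faces :=
  (h.mem_iff _).2 ⟨Finset.insert_nonempty _ _, Or.inr ⟨i, hi, subset_rfl⟩⟩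

theorem mem_verts_iff (h : K.IsFlapOn w v I f) (x : EuclideanSpace ℝ (Fin N)) :
    x ∈ K.verts ↔ x = w ∨ x = v ∨ ∃ i ∈ I, f i = x := by
  rw [mem_verts, h.mem_iff]
  simp only [Finset.singleton_nonempty, Finset.singleton_subset_iff, Finset.mem_insert,
    Finset.mem_singleton, true_and]
  constructor
  · rintro ((h | h) | ⟨i, hi, h | h | h⟩)
    · exact Or.inl h
    · exact Or.inr (Or.inl h)
    · exact Or.inl h
    · exact Or.inr (Or.inl h)
    · exact Or.inr (Or.inr ⟨i, hi, h.symm⟩)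
  · rintro (h | h | ⟨i, hi, h⟩)
    · exact Or.inl (Or.inl h)
    · exact Or.inl (Or.inr h)
    · exact Or.inr ⟨i, hi, Or.inr (Or.inr h.symm)⟩

theorem isCone (h : K.IsFlapOn w v I f) : K.IsCone w := by
  refine ⟨(h.mem_verts_iff w).2 (Or.inl rfl), fun s hs => ?_⟩
  rw [h.mem_iff] at hs ⊢
  refine ⟨Finset.insert_nonempty _ _, ?_⟩
  obtain ⟨-, hs | ⟨i, hi, hs⟩⟩ := hs
  · exact Or.inl (Finset.insert_subset (by simp) hs)
  · exact Or.inr ⟨i, hi, Finset.insert_subset (by simp) hs⟩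

theorem sum_verts (h : K.IsFlapOn w v I f) (F : EuclideanSpace ℝ (Fin N) → ℝ) :
    ∑ x ∈ K.verts, F x = F w + F v + ∑ i ∈ I, F (f i) := by
  classical
  have e : K.verts = insert w (insert v (I.image f)) := by
    ext x
    rw [h.mem_verts_iff]
    simp
  rw [e, Finset.sum_insert, Finset.sum_insert, Finset.sum_image h.injOn, add_assoc]
  · simp only [Finset.mem_image, not_exists, not_and]
    exact h.ne_right
  · simp only [Finset.mem_insert, Finset.mem_image, not_or, not_exists, not_and]
    exact ⟨h.ne, h.ne_left⟩

theorem map {L : Complex2 M} (h : K.IsFlapOn w v I f)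
    {g : EuclideanSpace ℝ (Fin N) → EuclideanSpace ℝ (Fin M)} (hg : K.IsSimplicialIso L g) :
    L.IsFlapOn (g w) (g v) I (g ∘ f) := by
  classical
  have hw := (h.mem_verts_iff w).2 (Or.inl rfl)
  have hv := (h.mem_verts_iff v).2 (Or.inr (Or.inl rfl))
  have hf : ∀ i ∈ I, f i ∈ K.verts := fun i hi =>
    (h.mem_verts_iff _).2 (Or.inr (Or.inr ⟨i, hi, rfl⟩))
  refine ⟨fun e => h.ne (hg.1.injOn hw hv e), hg.1.injOn.comp h.injOn hf,
    fun i hi e => h.ne_left i hi (hg.1.injOn (hf i hi) hw e),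
    fun i hi e => h.ne_right i hi (hg.1.injOn (hf i hi) hv e), fun t => ⟨fun ht => ?_, ?_⟩⟩
  · obtain ⟨s, hs, rfl⟩ := hg.exists_image_eq ht
    obtain ⟨hne, hs | ⟨i, hi, hs⟩⟩ := (h.mem_iff _).1 hs
    · have hs' := Finset.image_subset_image (f := g) hs
      exact ⟨hne.image g, Or.inl (by simpa only [Finset.image_insert, Finset.image_singleton]
        using hs')⟩
    · have hs' := Finset.image_subset_image (f := g) hs
      exact ⟨hne.image g, Or.inr ⟨i, hi,
        by simpa only [Finset.image_insert, Finset.image_singleton, Function.comp_apply] using hs'⟩⟩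
  · rintro ⟨hne, ht | ⟨i, hi, ht⟩⟩
    · refine L.down_closed (hg.image_mem h.edge_mem) ?_ hne
      simpa [Finset.image_insert] using ht
    · refine L.down_closed (hg.image_mem (h.triangle_mem hi)) ?_ hne
      simpa [Finset.image_insert] using ht

/-- Distinct triangles of a flap share only the edge `⟨w, v⟩`, so a tip lies in a single triangle.
-/
theorem closedStar_isTriangle (h : K.IsFlapOn w v I f) {i : ι} (hi : i ∈ I) :
    (K.closedStar (f i)).IsTriangle (f i) w v := by
  have h1 := h.ne_left i hi
  have h2 := h.ne_right i hi
  refine ⟨h1, h2, h.ne, fun s => ?_⟩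
  change (s ∈ K.faces ∧ insert (f i) s ∈ K.faces) ↔ _
  constructor
  · rintro ⟨hs, hs'⟩
    refine ⟨K.nonempty_of_mem_faces hs, (Finset.subset_insert (f i) s).trans ?_⟩
    obtain ⟨-, hs' | ⟨j, hj, hs'⟩⟩ := (h.mem_iff _).1 hs'
    · have := hs' (Finset.mem_insert_self _ _)
      simp [h1, h2] at this
    · have hij : f i = f j := by
        have := hs' (Finset.mem_insert_self _ _)
        simpa [h1, h2] using this
      rw [← hij] at hs'
      refine hs'.trans fun x hx => ?_
      simp only [Finset.mem_insert, Finset.mem_singleton] at hx ⊢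
      tauto
  · rintro ⟨hne, hs⟩
    have e : ({f i, w, v} : Finset (EuclideanSpace ℝ (Fin N))) = {w, v, f i} := by
      ext; simp; tauto
    rw [e] at hs
    exact ⟨K.down_closed (h.triangle_mem hi) hs hne, K.down_closed (h.triangle_mem hi)
      (Finset.insert_subset (by simp) hs) (Finset.insert_nonempty _ _)⟩

theorem ext {L : Complex2 N} (h : K.IsFlapOn w v I f) (h' : L.IsFlapOn w v I f) : K = L :=
  ext_faces (Set.ext fun s => (h.mem_iff s).trans (h'.mem_iff s).symm)

/-- Injectivity of `f` makes the triangles distinct, so their number is the number of indices. -/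
theorem isFlap (h : K.IsFlapOn w v I f) : K.IsFlap I.card := by
  classical
  have hcard : ∀ i ∈ I, ({w, v, f i} : Finset (EuclideanSpace ℝ (Fin N))).card = 3 := fun i hi =>
    Finset.card_eq_three.2 ⟨w, v, f i, h.ne, (h.ne_left i hi).symm, (h.ne_right i hi).symm, rfl⟩
  have hmem : ∀ s, s ∈ K.simplices 2 ↔ ∃ i ∈ I, {w, v, f i} = s := by
    intro s
    simp only [simplices, Finset.mem_filter, Set.Finite.mem_toFinset]
    constructor
    · rintro ⟨hs, h3⟩
      obtain ⟨-, hs | ⟨i, hi, hs⟩⟩ := (h.mem_iff _).1 hs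
      · have := (Finset.card_le_card hs).trans Finset.card_le_two
        omega
      · exact ⟨i, hi, (Finset.eq_of_subset_of_card_le hs (by rw [hcard i hi, h3])).symm⟩
    · rintro ⟨i, hi, rfl⟩
      exact ⟨h.triangle_mem hi, hcard i hi⟩
  refine ⟨w, v, h.ne, h.edge_mem, ?_, ?_, ?_⟩
  · have e : K.simplices 2 = I.image fun i => {w, v, f i} := by
      ext s
      rw [hmem, Finset.mem_image]
    rw [faceCount, e, Finset.card_image_of_injOn]
    intro i hi j hj hij
    refine h.injOn hi hj ?_
    have : f i ∈ ({w, v, f j} : Finset (EuclideanSpace ℝ (Fin N))) := by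
      rw [← show _ = ({w, v, f j} : Finset (EuclideanSpace ℝ (Fin N))) from hij]
      simp
    simpa [h.ne_left i hi, h.ne_right i hi] using this
  · intro s hs
    obtain ⟨i, -, rfl⟩ := (hmem s).1 hs
    simp
  · intro s hs
    obtain ⟨-, hs | ⟨i, hi, hs⟩⟩ := (h.mem_iff _).1 hs
    · exact Or.inl hs
    · exact Or.inr ⟨_, (hmem _).2 ⟨i, hi, rfl⟩, hs⟩

end IsFlapOn

/-- Subdividing an edge of a triangle gives a flap with two triangles. -/
theorem IsTriangle.splitEdge_isFlapOn {K : Complex2 N} {a b c : EuclideanSpace ℝ (Fin N)}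
    (h : K.IsTriangle a b c) {l : ℝ} (hbc : {b, c} ∈ K.faces) (h0 : 0 < l) (h1 : l < 1) :
    (K.splitEdge b c l hbc h.ne₃ h0 h1).IsFlapOn a (AffineMap.lineMap b c l) {b, c} id := by
  have hpv := K.lineMap_notMem_verts hbc h.ne₃ h0 h1
  have hfaces : (K.splitEdge b c l hbc h.ne₃ h0 h1).faces =
    K.splitFaces b c (AffineMap.lineMap b c l) := rfl
  rw [h.verts_eq] at hpv
  set p : EuclideanSpace ℝ (Fin N) := AffineMap.lineMap b c l
  simp only [Finset.mem_insert, Finset.mem_singleton, not_or] at hpv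
  obtain ⟨hpa, hpb, hpc⟩ := hpv
  have n1 := h.ne₁
  have n2 := h.ne₂
  have n3 := h.ne₃
  refine ⟨Ne.symm hpa, Set.injOn_id _, ?_, ?_, fun s => ?_⟩
  · simp [n1.symm, n2.symm]
  · simp [Ne.symm hpb, Ne.symm hpc]
  · rw [hfaces, splitFaces, Set.mem_ofPred_eq]
    simp only [h.mem_iff, Finset.insert_nonempty, true_and, Finset.mem_insert,
      Finset.mem_singleton, exists_eq_or_imp, exists_eq_left, id, Finset.subset_iff,
      Finset.mem_erase]
    constructor
    · rintro ⟨hn, ⟨hp, hne, hs⟩ | ⟨hp, hs⟩⟩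
      · refine ⟨hne, Or.inr ?_⟩
        by_cases hb : b ∈ s
        · left; intro x hx; have := hs hx; grind
        · right; intro x hx; have := hs hx; grind
      · refine ⟨⟨p, hp⟩, Or.inr ?_⟩
        by_cases hb : b ∈ s
        · left; intro x hx; by_cases hxp : x = p
          · grind
          · have := hs (Or.inr (Or.inr ⟨hxp, hx⟩)); grind
        · right; intro x hx; by_cases hxp : x = p
          · grind
          · have := hs (Or.inr (Or.inr ⟨hxp, hx⟩)); grind
    · rintro ⟨hne, hs⟩
      have hs' : (∀ x ∈ s, x = a ∨ x = p ∨ x = b) ∨ ∀ x ∈ s, x = a ∨ x = p ∨ x = c := by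
        rcases hs with hs | hs | hs
        · left; intro x hx; have := hs hx; tauto
        · left; intro x hx; exact hs hx
        · right; intro x hx; exact hs hx
      refine ⟨?_, ?_⟩
      · rintro ⟨hb, hc⟩
        rcases hs' with hs' | hs'
        · obtain h | h | h := hs' c hc
          exacts [n2 h.symm, hpc h.symm, n3 h.symm]
        · obtain h | h | h := hs' b hb
          exacts [n1 h.symm, hpb h.symm, n3 h]
      · by_cases hp : p ∈ s
        · refine Or.inr ⟨hp, fun x hx => ?_⟩
          rcases hs' with hs' | hs' <;> grind
        · refine Or.inl ⟨hp, hne, fun x hx => ?_⟩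
          rcases hs' with hs' | hs' <;> grind

theorem IsTriangle.carrier_eq {K : Complex2 N} {a b c : EuclideanSpace ℝ (Fin N)}
    (h : K.IsTriangle a b c) : K.carrier = convexHull ℝ {a, b, c} := by
  refine Set.Subset.antisymm (fun x hx => ?_) fun x hx => ?_
  · obtain ⟨s, hs, hx⟩ := Geometry.SimplicialComplex.mem_space_iff.1 hx
    refine convexHull_mono ?_ hx
    intro y hy
    have := ((h.mem_iff s).1 hs).2 hy
    simpa using this
  · exact Geometry.SimplicialComplex.mem_space_iff.2 ⟨_, h.mem_faces, by simpa using hx⟩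

/-- The points of an edge of a triangle are not interior points of the triangle. -/
theorem IsTriangle.segment_subset_frontier {K : Complex2 2} {a b c : EuclideanSpace ℝ (Fin 2)}
    (h : K.IsTriangle a b c) : segment ℝ b c ⊆ frontier K.carrier := by
  intro x hx
  have hxK : x ∈ K.carrier := by
    rw [h.carrier_eq]
    exact convexHull_mono (by simp) (segment_subset_convexHull (s := {b, c}) (by simp) (by simp) hx)
  refine ⟨subset_closure hxK, fun hint => ?_⟩
  -- If `x` were interior, the segment from `a` to `x` could be prolonged slightly beyond `x` within
  -- the triangle.
  have hcont : Filter.Tendsto (fun e : ℝ => AffineMap.lineMap a x (1 + e))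
      (nhdsWithin 0 (Set.Ioi 0)) (nhds x) := by
    have : Continuous fun e : ℝ => AffineMap.lineMap a x (1 + e) := by
      simp only [AffineMap.lineMap_apply_module]
      fun_prop
    have h2 := (this.tendsto 0).mono_left (nhdsWithin_le_nhds (s := Set.Ioi (0 : ℝ)))
    simpa using h2
  have h3 : ∀ᶠ e in nhdsWithin (0 : ℝ) (Set.Ioi 0), 0 < e := self_mem_nhdsWithin
  obtain ⟨e, hep, he⟩ := (h3.and (hcont.eventually
    (mem_interior_iff_mem_nhds.1 hint))).exists
  replace he : AffineMap.lineMap a x (1 + e) ∈ K.carrier := he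
  rw [h.carrier_eq] at he
  have he' : AffineMap.lineMap a x (1 + e) ∈
      convexHull ℝ (({a, b, c} : Finset (EuclideanSpace ℝ (Fin 2))) : Set _) := by simpa using he
  obtain ⟨u, hu, hus, hux⟩ := mem_convexHull_iff_bary.1 he'
  have hx' : x ∈ convexHull ℝ (({b, c} : Finset (EuclideanSpace ℝ (Fin 2))) : Set _) := by
    simpa [convexHull_pair] using hx
  obtain ⟨w, hw, hws, hwx⟩ := mem_convexHull_iff_bary.1 hx'
  -- The prolonged point `y` satisfies `y + e • a = (1 + e) • x`. The left side gives `a` weight at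
  -- least `e`, whereas `x` lies on the opposite edge and gives it weight 0.
  have key := K.uniqueBary _ h.mem_faces _ h.mem_faces (u + e • Finsupp.single a 1) ((1 + e) • w)
    (add_nonneg hu (smul_nonneg hep.le (Finsupp.single_nonneg.2 zero_le_one)))
    (smul_nonneg (by linarith) hw)
    (Finsupp.support_add.trans (Finset.union_subset hus (Finsupp.support_smul.trans
      (Finsupp.support_single_subset.trans (by simp)))))
    (Finsupp.support_smul.trans (hws.trans (by simp)))
    (by
      rw [map_add, map_smul, map_smul, hux, hwx, bary_single, AffineMap.lineMap_apply_module]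
      ext1
      · simp
      · simp only [Prod.snd_add, Prod.smul_snd]
        module)
  have ha := DFunLike.congr_fun key a
  have hwa : w a = 0 := Finsupp.notMem_support_iff.1 fun h' => by
    have := hws h'
    simp [h.ne₁, h.ne₂] at this
  have hua : 0 ≤ u a := hu a
  simp [hwa] at ha
  linarith

/-- A compact convex set with nonempty interior in the plane is homeomorphic to the disk. -/
theorem IsTriangle.carrier_homeomorph {K : Complex2 2} {a b c : EuclideanSpace ℝ (Fin 2)}
    (h : K.IsTriangle a b c) :
    Nonempty (K.carrier ≃ₜ Metric.closedBall (0 : EuclideanSpace ℝ (Fin 2)) 1) := by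
  have hfin : ({a, b, c} : Set (EuclideanSpace ℝ (Fin 2))).Finite := Set.toFinite _
  have hconv : Convex ℝ K.carrier := by rw [h.carrier_eq]; exact convex_convexHull ℝ _
  have hcomp : IsCompact K.carrier := by rw [h.carrier_eq]; exact hfin.isCompact_convexHull ℝ
  have hint : (interior K.carrier).Nonempty := by
    rw [h.carrier_eq, interior_convexHull_nonempty_iff_affineSpan_eq_top]
    have hi := affineIndependent_iff_not_collinear_set.2 h.not_collinear
    have hr : Set.range ![a, b, c] = {a, b, c} := by
      ext x
      simp [or_comm, or_left_comm, eq_comm]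
    rw [← hr, AffineIndependent.affineSpan_eq_top_iff_card_eq_finrank_add_one hi]
    simp
  obtain ⟨e, -, he, -⟩ := exists_homeomorph_image_interior_closure_frontier_eq_unitBall hconv hint
    hcomp.isBounded
  rw [hcomp.isClosed.closure_eq] at he
  exact ⟨(e.image K.carrier).trans (Homeomorph.setCongr he)⟩

theorem IsTriangle.isPlanarFan {K : Complex2 2} {a b c : EuclideanSpace ℝ (Fin 2)}
    (h : K.IsTriangle a b c) : K.IsPlanarFan := by
  refine ⟨h.carrier_homeomorph, fun x hx => ?_, a, h.isCone.1, h.isCone.2⟩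
  rw [h.verts_eq] at hx
  simp only [Finset.mem_insert, Finset.mem_singleton] at hx
  obtain rfl | rfl | rfl := hx
  · exact h.rotate.segment_subset_frontier (right_mem_segment ℝ _ _)
  · exact h.segment_subset_frontier (left_mem_segment ℝ _ _)
  · exact h.segment_subset_frontier (right_mem_segment ℝ _ _)

/-- The underlying disk is unchanged, the new vertex lies on its boundary, and the subdivision is a
cone from the opposite vertex `a`. -/
theorem IsTriangle.splitEdge_isPlanarFan {K : Complex2 2} {a b c : EuclideanSpace ℝ (Fin 2)}
    (h : K.IsTriangle a b c) {l : ℝ} (hbc : {b, c} ∈ K.faces) (h0 : 0 < l) (h1 : l < 1) :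
    (K.splitEdge b c l hbc h.ne₃ h0 h1).IsPlanarFan := by
  have hf := h.splitEdge_isFlapOn hbc h0 h1
  have hc : (K.splitEdge b c l hbc h.ne₃ h0 h1).carrier = K.carrier :=
    (splitEdge_isSubdivision hbc h.ne₃ h0 h1).1
  refine ⟨hc ▸ h.carrier_homeomorph, fun x hx => ?_, a, hf.isCone.1, hf.isCone.2⟩
  rw [hc]
  obtain rfl | rfl | ⟨i, hi, rfl⟩ := (hf.mem_verts_iff x).1 hx
  · exact h.rotate.segment_subset_frontier (right_mem_segment ℝ _ _)
  · exact h.segment_subset_frontier (lineMap_mem_segment ℝ _ _ ⟨h0.le, h1.le⟩)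
  · simp only [Finset.mem_insert, Finset.mem_singleton] at hi
    obtain rfl | rfl := hi
    · exact h.segment_subset_frontier (left_mem_segment ℝ _ _)
    · exact h.segment_subset_frontier (right_mem_segment ℝ _ _)

end Complex2

/-! ### Functions with constant sum over the angles of a triangle -/

/-- A continuous function on an interval that takes midpoints to midpoints is affine. -/
theorem eqOn_affine_of_midpoint {f : ℝ → ℝ} {a b : ℝ} (hab : a < b)
    (hf : ContinuousOn f (Set.Icc a b))
    (hm : ∀ x ∈ Set.Icc a b, ∀ y ∈ Set.Icc a b, f x + f y = 2 * f ((x + y) / 2)) :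
    ∃ c k : ℝ, ∀ x ∈ Set.Icc a b, f x = c + k * x := by
  have main : ∀ g : ℝ → ℝ, ContinuousOn g (Set.Icc a b) →
      (∀ x ∈ Set.Icc a b, ∀ y ∈ Set.Icc a b, g x + g y = 2 * g ((x + y) / 2)) →
      g a = 0 → g b = 0 → ∀ x ∈ Set.Icc a b, g x ≤ 0 := by
    intro g hg hm ha hb x hx
    obtain ⟨z, hz, hmax⟩ := isCompact_Icc.exists_isMaxOn ⟨a, Set.left_mem_Icc.2 hab.le⟩ hg
    have hmax' : ∀ y ∈ Set.Icc a b, g y ≤ g z := fun y hy => hmax hy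
    refine (hmax' x hx).trans ?_
    -- Maximum principle: reflect the nearer end of the interval through a maximum point `z`. As `g`
    -- vanishes at the end, `2 * g z` is the value at the reflected point, which is at most `g z`.
    rcases le_total (z - a) (b - z) with h | h
    · have hy : 2 * z - a ∈ Set.Icc a b := ⟨by linarith [hz.1], by linarith⟩
      have := hm a (Set.left_mem_Icc.2 hab.le) _ hy
      rw [show (a + (2 * z - a)) / 2 = z by ring, ha] at this
      linarith [hmax' _ hy]
    · have hy : 2 * z - b ∈ Set.Icc a b := ⟨by linarith, by linarith [hz.2]⟩
      have := hm b (Set.right_mem_Icc.2 hab.le) _ hy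
      rw [show (b + (2 * z - b)) / 2 = z by ring, hb] at this
      linarith [hmax' _ hy]
  have hne : b - a ≠ 0 := (sub_pos.2 hab).ne'
  -- The maximum principle is applied to `f` minus its chord and to the negative of this difference.
  set k := (f b - f a) / (b - a) with hk
  have hkb : k * (b - a) = f b - f a := div_mul_cancel₀ _ hne
  refine ⟨f a - k * a, k, fun x hx => ?_⟩
  have hl : ContinuousOn (fun x => f a - k * a + k * x) (Set.Icc a b) := by fun_prop
  have h1 := main (fun x => f x - (f a - k * a + k * x)) (hf.sub hl)
    (fun x hx y hy => by have := hm x hx y hy; linarith) (by simp) (by linarith)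
    x hx
  have h2 := main (fun x => (f a - k * a + k * x) - f x) (hl.sub hf)
    (fun x hx y hy => by have := hm x hx y hy; linarith) (by simp) (by linarith)
    x hx
  linarith

/-- A continuous function whose values at the angles of all triangles have the same sum is
affine. -/
theorem affine_of_triangle_sum {f : ℝ → ℝ} {S : ℝ} (hf : ContinuousOn f (Set.Ioo 0 Real.pi))
    (hs : ∀ x y z : ℝ, 0 < x → 0 < y → 0 < z → x + y + z = Real.pi → f x + f y + f z = S) :
    ∃ c k : ℝ, ∀ x ∈ Set.Ioo 0 Real.pi, f x = c + k * x := by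
  have hpi := Real.pi_pos
  have hloc : ∀ a b : ℝ, 0 < a → a < b → b < Real.pi / 2 →
      ∃ c k : ℝ, ∀ x ∈ Set.Icc a b, f x = c + k * x := by
    intro a b ha hab hb
    refine eqOn_affine_of_midpoint hab (hf.mono fun x hx => ⟨by linarith [hx.1],
      by linarith [hx.2]⟩) fun x hx y hy => ?_
    have hx1 := hx.1
    have hx2 := hx.2
    have hy1 := hy.1
    have hy2 := hy.2
    -- Replacing two angles by their mean keeps the third angle, hence the sum of the two values.
    -- The bound `b < π / 2` makes the third angle positive.
    have e1 := hs x y (Real.pi - x - y) (by linarith) (by linarith) (by linarith) (by ring)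
    have e2 := hs ((x + y) / 2) ((x + y) / 2) (Real.pi - x - y) (by linarith) (by linarith)
      (by linarith) (by ring)
    linarith
  obtain ⟨c, k, hck⟩ := hloc (Real.pi / 6) (Real.pi / 3) (by linarith) (by linarith) (by linarith)
  have hhalf : ∀ x, 0 < x → x < Real.pi / 2 → f x = c + k * x := by
    intro x hx0 hx
    have b1 : min x (Real.pi / 6) ≤ x := min_le_left _ _
    have b2 : min x (Real.pi / 6) ≤ Real.pi / 6 := min_le_right _ _
    have b3 : x ≤ max x (Real.pi / 3) := le_max_left _ _
    have b4 : Real.pi / 3 ≤ max x (Real.pi / 3) := le_max_right _ _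
    -- The interval is enlarged to contain `π / 6` and `π / 3`; agreement at these two points
    -- identifies the affine functions.
    obtain ⟨c', k', h'⟩ := hloc (min x (Real.pi / 6)) (max x (Real.pi / 3))
      (lt_min hx0 (by linarith)) (by linarith) (max_lt hx (by linarith))
    have e1 := hck (Real.pi / 6) ⟨le_rfl, by linarith⟩
    have e2 := hck (Real.pi / 3) ⟨by linarith, le_rfl⟩
    rw [h' _ ⟨b2, by linarith⟩] at e1
    rw [h' _ ⟨by linarith, b4⟩] at e2
    have hk : k' = k := by
      have : (k' - k) * (Real.pi / 6) = 0 := by linarith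
      rcases mul_eq_zero.1 this with h | h
      · linarith
      · linarith
    subst hk
    rw [h' x ⟨b1, b3⟩]
    linarith
  refine ⟨c, k, fun x hx => ?_⟩
  have hx0 := hx.1
  have hx1 := hx.2
  -- Any angle is completed to a triangle by two equal acute angles, where `f` is already known; the
  -- equilateral triangle supplies `S`.
  have e1 := hs x ((Real.pi - x) / 2) ((Real.pi - x) / 2) hx0 (by linarith) (by linarith) (by ring)
  have e2 := hs (Real.pi / 3) (Real.pi / 3) (Real.pi / 3) (by linarith) (by linarith) (by linarith)
    (by ring)
  rw [hhalf ((Real.pi - x) / 2) (by linarith) (by linarith)] at e1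
  rw [hhalf (Real.pi / 3) (by linarith) (by linarith)] at e2
  linarith

/-! ### Plane triangles with given angles -/

/-- The sign `e = ±1` covers both angles at the base of a triangle, measured from opposite
directions of the first axis. -/
theorem angle_unit_vectors {e t : ℝ} (he : e * e = 1) (h0 : 0 ≤ t) (h1 : t ≤ Real.pi) :
    InnerProductGeometry.angle (!₂[e, 0] : EuclideanSpace ℝ (Fin 2)) !₂[e * Real.cos t, Real.sin t]
      = t := by
  have n1 : ‖(!₂[e, 0] : EuclideanSpace ℝ (Fin 2))‖ = 1 := by
    rw [EuclideanSpace.norm_eq]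
    simp [Fin.sum_univ_two, sq, he]
  have n2 : ‖(!₂[e * Real.cos t, Real.sin t] : EuclideanSpace ℝ (Fin 2))‖ = 1 := by
    rw [EuclideanSpace.norm_eq]
    have := Real.sin_sq_add_cos_sq t
    have h : e * Real.cos t * (e * Real.cos t) + Real.sin t * Real.sin t = 1 := by
      linear_combination (Real.cos t ^ 2) * he + this
    simp [Fin.sum_univ_two, sq, h]
  have n3 : inner ℝ (!₂[e, 0] : EuclideanSpace ℝ (Fin 2)) !₂[e * Real.cos t, Real.sin t] =
      Real.cos t := by
    have h : e * Real.cos t * e = Real.cos t := by linear_combination Real.cos t * he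
    simp [PiLp.inner_apply, Fin.sum_univ_two, h]
  rw [InnerProductGeometry.angle, n1, n2, n3, mul_one, div_one, Real.arccos_cos h0 h1]

namespace Complex2

variable {N M : ℕ}

theorem IsTriangle.angle_mem_Ioo {K : Complex2 N} {a b c : EuclideanSpace ℝ (Fin N)}
    (h : K.IsTriangle a b c) : EuclideanGeometry.angle b a c ∈ Set.Ioo 0 Real.pi := by
  have hc := h.rotate.rotate.swap.rotate.not_collinear
  have hc' : ¬ Collinear ℝ {b, a, c} := by rwa [Set.insert_comm] at hc ⊢
  rw [EuclideanGeometry.collinear_iff_eq_or_eq_or_angle_eq_zero_or_angle_eq_pi] at hc'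
  push Not at hc'
  exact ⟨lt_of_le_of_ne (EuclideanGeometry.angle_nonneg _ _ _) (Ne.symm hc'.2.2.1),
    lt_of_le_of_ne (EuclideanGeometry.angle_le_pi _ _ _) hc'.2.2.2⟩

theorem exists_isTriangle_of_angle {a b c : EuclideanSpace ℝ (Fin N)} (hb : b ≠ a) (hc : c ≠ a)
    (h : EuclideanGeometry.angle b a c ∈ Set.Ioo 0 Real.pi) :
    ∃ K : Complex2 N, K.IsTriangle a b c := by
  refine exists_isTriangle ?_
  rw [Set.insert_comm, EuclideanGeometry.collinear_iff_eq_or_eq_or_angle_eq_zero_or_angle_eq_pi]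
  push Not
  exact ⟨hb, hc, h.1.ne', h.2.ne⟩

/-- There is a triangle in the plane with given angles. -/
theorem exists_isTriangle_angles {x y z : ℝ} (hx : 0 < x) (hy : 0 < y) (hz : 0 < z)
    (hxyz : x + y + z = Real.pi) :
    ∃ (K : Complex2 2) (a b c : EuclideanSpace ℝ (Fin 2)), K.IsTriangle a b c ∧
      EuclideanGeometry.angle b a c = x ∧ EuclideanGeometry.angle c b a = y ∧
      EuclideanGeometry.angle a c b = z := by
  have sx : 0 < Real.sin x := Real.sin_pos_of_pos_of_lt_pi hx (by linarith)
  have sy : 0 < Real.sin y := Real.sin_pos_of_pos_of_lt_pi hy (by linarith)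
  have sxy : 0 < Real.sin (x + y) := Real.sin_pos_of_pos_of_lt_pi (by linarith) (by linarith)
  -- By the law of sines the sides may be taken to be the sines of the opposite angles; `sin (x +
  -- y)` is the sine of `z`. The first vertex is the origin.
  set b : EuclideanSpace ℝ (Fin 2) := Real.sin (x + y) • !₂[1, 0] with hb
  set c : EuclideanSpace ℝ (Fin 2) := Real.sin y • !₂[1 * Real.cos x, Real.sin x] with hc
  have hb0 : b ≠ 0 := by
    intro h
    have := congrArg (fun v => v 0) h
    simp [hb, sxy.ne'] at this
  have hc0 : c ≠ 0 := by
    intro h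
    have := congrArg (fun v => v 1) h
    simp [hc, sx.ne', sy.ne'] at this
  have hcb : c - b = Real.sin x • !₂[-1 * Real.cos y, Real.sin y] := by
    ext i
    fin_cases i
    · simp [hb, hc, Real.sin_add]; ring
    · simp [hb, hc]; ring
  have hbm : -b = Real.sin (x + y) • !₂[-1, 0] := by
    ext i
    fin_cases i <;> simp [hb]
  have ax : EuclideanGeometry.angle b 0 c = x := by
    rw [EuclideanGeometry.angle, vsub_eq_sub, vsub_eq_sub, sub_zero, sub_zero, hb, hc,
      InnerProductGeometry.angle_smul_left_of_pos _ _ sxy,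
      InnerProductGeometry.angle_smul_right_of_pos _ _ sy,
      angle_unit_vectors (by norm_num) hx.le (by linarith)]
  have ay : EuclideanGeometry.angle c b 0 = y := by
    rw [EuclideanGeometry.angle_comm, EuclideanGeometry.angle, vsub_eq_sub, vsub_eq_sub, zero_sub,
      hcb, hbm, InnerProductGeometry.angle_smul_left_of_pos _ _ sxy,
      InnerProductGeometry.angle_smul_right_of_pos _ _ sx,
      angle_unit_vectors (by norm_num) hy.le (by linarith)]
  obtain ⟨K, hK⟩ := exists_isTriangle_of_angle hb0 hc0 (ax ▸ ⟨hx, by linarith⟩ :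
    EuclideanGeometry.angle b 0 c ∈ Set.Ioo 0 Real.pi)
  refine ⟨K, 0, b, c, hK, ax, ay, ?_⟩
  have := EuclideanGeometry.angle_add_angle_add_angle_eq_pi c hb0
  rw [EuclideanGeometry.angle_comm 0 b c, EuclideanGeometry.angle_comm b c 0,
    EuclideanGeometry.angle_comm c 0 b] at this
  linarith

end Complex2

/-! ### The value at a vertex of a triangle -/

section VertexFunctions

open Complex2

variable {N M : ℕ} {T : ComplexClass} {φ : VertexFunction} {Λ : ComplexFunction} {Λfan : ℝ}

theorem phi_triangle_eq (hstar : T.StarClosed) (hsub : T.SubdivisionClosed)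
    (hI : φ.InvariantUnderStarIsometries T) (hS : φ.InvariantUnderSubdivision T)
    {K : Complex2 N} (hK : K ∈ T N) {L : Complex2 M} (hL : L ∈ T M)
    {a b c : EuclideanSpace ℝ (Fin N)} {a' b' c' : EuclideanSpace ℝ (Fin M)}
    (hKt : K.IsTriangle a b c) (hLt : L.IsTriangle a' b' c')
    (h : EuclideanGeometry.angle b a c = EuclideanGeometry.angle b' a' c') :
    φ N K a = φ M L a' := by
  classical
  let g : EuclideanSpace ℝ (Fin N) → EuclideanSpace ℝ (Fin M) := fun x =>
    if x = a then a' else if x = b then b' else c'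
  have ga : g a = a' := if_pos rfl
  have gb : g b = b' := by simp [g, hKt.ne₁.symm]
  have gc : g c = c' := by simp [g, hKt.ne₂.symm, hKt.ne₃.symm]
  refine phi_eq_of_angles hstar hsub hI hS hK hL hKt.isCone (hKt.isSimplicialIso hLt ga gb gc) ga
    fun x y hxy hxa hya hne => ?_
  have hx := K.subset_verts hxy (show x ∈ ({x, y} : Finset _) by simp)
  have hy := K.subset_verts hxy (show y ∈ ({x, y} : Finset _) by simp)
  rw [hKt.verts_eq] at hx hy
  simp only [Finset.mem_insert, Finset.mem_singleton, hxa, hya, false_or] at hx hy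
  rcases hx with rfl | rfl <;> rcases hy with rfl | rfl
  · exact absurd rfl hne
  · rw [gb, gc, h]
  · rw [gb, gc, EuclideanGeometry.angle_comm, h, EuclideanGeometry.angle_comm]
  · exact absurd rfl hne

/-- The value at a vertex of a triangle is a function of the angle. -/
theorem exists_angle_function (hstar : T.StarClosed) (hsub : T.SubdivisionClosed)
    (hI : φ.InvariantUnderStarIsometries T) (hS : φ.InvariantUnderSubdivision T) :
    ∃ h : ℝ → ℝ, ∀ (N : ℕ), ∀ K ∈ T N, ∀ a b c : EuclideanSpace ℝ (Fin N), K.IsTriangle a b c →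
      φ N K a = h (EuclideanGeometry.angle b a c) := by
  classical
  let Q : ℝ → ℝ → Prop := fun t y => ∃ (N : ℕ) (K : Complex2 N) (a b c : EuclideanSpace ℝ (Fin N)),
    K ∈ T N ∧ K.IsTriangle a b c ∧ EuclideanGeometry.angle b a c = t ∧ φ N K a = y
  -- The default 0 applies only to numbers that are not an angle of a triangle in the class. By
  -- `phi_triangle_eq` the chosen value does not depend on the triangle.
  refine ⟨fun t => if H : ∃ y, Q t y then H.choose else 0, fun N K hK a b c hKt => ?_⟩
  have H : ∃ y, Q (EuclideanGeometry.angle b a c) y := ⟨_, N, K, a, b, c, hK, hKt, rfl, rfl⟩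
  refine Eq.trans ?_ (dif_pos H).symm
  obtain ⟨M, L, a', b', c', hL, hLt, hang, hy⟩ := H.choose_spec
  rw [← hy]
  exact phi_triangle_eq hstar hsub hI hS hK hL hKt hLt hang.symm

/-- Each angle is realized by a planar triangle with vertices at the origin, at a fixed unit vector
and at a point of the unit circle that moves continuously with the angle. Condition 3 for these
triangles is sequential continuity. -/
theorem continuousOn_angle_function (hfan : ∀ K : Complex2 2, K.IsPlanarFan → K ∈ T 2)
    (hC : φ.IsContinuous T) {h : ℝ → ℝ}
    (hh : ∀ (N : ℕ), ∀ K ∈ T N, ∀ a b c : EuclideanSpace ℝ (Fin N), K.IsTriangle a b c →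
      φ N K a = h (EuclideanGeometry.angle b a c)) : ContinuousOn h (Set.Ioo 0 Real.pi) := by
  classical
  let b : EuclideanSpace ℝ (Fin 2) := !₂[1, 0]
  let c : ℝ → EuclideanSpace ℝ (Fin 2) := fun t => !₂[1 * Real.cos t, Real.sin t]
  have hcc : Continuous c := by
    refine (PiLp.continuous_toLp 2 _).comp (continuous_pi fun i => ?_)
    fin_cases i
    · simpa using Real.continuous_cos
    · simpa using Real.continuous_sin
  have hang : ∀ t ∈ Set.Ioo 0 Real.pi, EuclideanGeometry.angle b 0 (c t) = t := fun t ht => by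
    rw [EuclideanGeometry.angle, vsub_eq_sub, vsub_eq_sub, sub_zero, sub_zero]
    exact angle_unit_vectors (by norm_num) ht.1.le ht.2.le
  have hb0 : b ≠ 0 := fun h => by
    have := congrArg (fun v => v 0) h
    simp [b] at this
  have hc0 : ∀ t ∈ Set.Ioo 0 Real.pi, c t ≠ 0 := fun t ht h => by
    have := congrArg (fun v => v 1) h
    simp [c, (Real.sin_pos_of_pos_of_lt_pi ht.1 ht.2).ne'] at this
  have hex : ∀ t : Set.Ioo 0 Real.pi, ∃ K : Complex2 2, K.IsTriangle 0 b (c t) := fun t =>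
    exists_isTriangle_of_angle hb0 (hc0 t t.2) ((hang t t.2).symm ▸ t.2)
  choose K hK using hex
  have hval : ∀ t : Set.Ioo 0 Real.pi, φ 2 (K t) 0 = h t := fun t => by
    rw [hh 2 (K t) (hfan _ (hK t).isPlanarFan) 0 b (c t) (hK t), hang t t.2]
  rw [continuousOn_iff_continuous_domRestrict, continuous_iff_seqContinuous]
  intro u p hu
  let g : ℕ → EuclideanSpace ℝ (Fin 2) → EuclideanSpace ℝ (Fin 2) := fun n z =>
    if z = c p then c (u n) else z
  have g0 : ∀ n, g n 0 = 0 := fun n => if_neg (hK p).ne₂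
  have gb : ∀ n, g n b = b := fun n => if_neg (hK p).ne₃
  have gc : ∀ n, g n (c p) = c (u n) := fun n => if_pos rfl
  have key := hC 2 (K p) (hfan _ (hK p).isPlanarFan) (fun n => K (u n)) g
    (fun n => hfan _ (hK (u n)).isPlanarFan)
    (fun n => (hK p).isSimplicialIso (hK (u n)) (g0 n) (gb n) (gc n)) ?_ 0 (hK p).isCone.1
  · simp only [g0, hval] at key
    exact key
  · intro x hx
    rw [(hK p).verts_eq] at hx
    simp only [Finset.mem_insert, Finset.mem_singleton] at hx
    obtain rfl | rfl | rfl := hx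
    · simp [g0]
    · simp [gb]
    · simp only [gc]
      exact ((hcc.comp continuous_subtype_val).tendsto p).comp hu

theorem sum_angle_function (hfan : ∀ K : Complex2 2, K.IsPlanarFan → K ∈ T 2)
    (hD : φ.SatisfiesDGB T Λ) (hΛfan : ∀ K : Complex2 2, K.IsPlanarFan → Λ 2 K = Λfan) {h : ℝ → ℝ}
    (hh : ∀ (N : ℕ), ∀ K ∈ T N, ∀ a b c : EuclideanSpace ℝ (Fin N), K.IsTriangle a b c →
      φ N K a = h (EuclideanGeometry.angle b a c)) {x y z : ℝ} (hx : 0 < x) (hy : 0 < y)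
    (hz : 0 < z) (hxyz : x + y + z = Real.pi) : h x + h y + h z = Λfan := by
  obtain ⟨K, a, b, c, hK, rfl, rfl, rfl⟩ := exists_isTriangle_angles hx hy hz hxyz
  have hKT := hfan K hK.isPlanarFan
  rw [← hΛfan K hK.isPlanarFan, ← hD 2 K hKT, hK.verts_eq, Finset.sum_insert, Finset.sum_insert,
    Finset.sum_singleton, hh 2 K hKT a b c hK, hh 2 K hKT b c a hK.rotate,
    hh 2 K hKT c a b hK.rotate.rotate, add_assoc]
  · simpa using hK.ne₃
  · simpa using ⟨hK.ne₁, hK.ne₂⟩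

/-- The value at the midpoint of an edge of a planar triangle is zero. -/
theorem phi_midpoint_splitEdge (hfan : ∀ K : Complex2 2, K.IsPlanarFan → K ∈ T 2)
    (hS : φ.InvariantUnderSubdivision T) (hD : φ.SatisfiesDGB T Λ)
    (hΛfan : ∀ K : Complex2 2, K.IsPlanarFan → Λ 2 K = Λfan)
    {K : Complex2 2} {a b c : EuclideanSpace ℝ (Fin 2)} (h : K.IsTriangle a b c) {l : ℝ}
    (hbc : {b, c} ∈ K.faces) (h0 : 0 < l) (h1 : l < 1) :
    φ 2 (K.splitEdge b c l hbc h.ne₃ h0 h1) (AffineMap.lineMap b c l) = 0 := by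
  have hJf := h.splitEdge_isPlanarFan hbc h0 h1
  have hsd := splitEdge_isSubdivision hbc h.ne₃ h0 h1
  have hKT := hfan K h.isPlanarFan
  -- Both complexes are fans with the same total, and the three old vertices keep their values, so
  -- nothing remains for the new vertex.
  have e1 := hD 2 K hKT
  have e2 := hD 2 _ (hfan _ hJf)
  rw [hΛfan K h.isPlanarFan, h.verts_eq, Finset.sum_insert, Finset.sum_pair h.ne₃] at e1
  · rw [hΛfan _ hJf, (h.splitEdge_isFlapOn hbc h0 h1).sum_verts, Finset.sum_pair h.ne₃] at e2
    have hinv : ∀ x ∈ K.verts, φ 2 K x = φ 2 (K.splitEdge b c l hbc h.ne₃ h0 h1) x := fun x hx =>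
      hS 2 K hKT _ (hfan _ hJf) x hx hsd
    rw [hinv a (by simp [h.verts_eq]), hinv b (by simp [h.verts_eq]),
      hinv c (by simp [h.verts_eq])] at e1
    simp only [id] at e2
    linarith
  · simpa using ⟨h.ne₁, h.ne₂⟩

end VertexFunctions

/-- Indexing the tips by themselves lets flaps that arise in different ways be identified by
`IsFlapOn.ext`. -/
theorem Complex2.IsFlapOn.image {N : ℕ} {ι : Type*} {K : Complex2 N}
    {w v : EuclideanSpace ℝ (Fin N)} {I : Finset ι} {f : ι → EuclideanSpace ℝ (Fin N)}
    (h : K.IsFlapOn w v I f) : K.IsFlapOn w v (I.image f) id := by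
  refine ⟨h.ne, Set.injOn_id _, ?_, ?_, fun s => ?_⟩
  · simpa using h.ne_left
  · simpa using h.ne_right
  · rw [h.mem_iff]
    simp

section VertexFunctions

open Complex2

variable {N M : ℕ} {T : ComplexClass} {φ : VertexFunction} {Λ : ComplexFunction} {Λfan : ℝ}

/-- In a kite `a b d c` whose diagonal `a d` meets the segment `b c` in its midpoint, the value at
`d` is that at the vertex `d` of the triangle `d b c`. -/
theorem phi_kite (hstar : T.StarClosed) (hsub : T.SubdivisionClosed)
    (hfan : ∀ K : Complex2 2, K.IsPlanarFan → K ∈ T 2)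
    (hI : φ.InvariantUnderStarIsometries T) (hS : φ.InvariantUnderSubdivision T) {h : ℝ → ℝ}
    (hh : ∀ (N : ℕ), ∀ K ∈ T N, ∀ a b c : EuclideanSpace ℝ (Fin N), K.IsTriangle a b c →
      φ N K a = h (EuclideanGeometry.angle b a c))
    {J : Complex2 2} (hJ : J ∈ T 2) {a d b c : EuclideanSpace ℝ (Fin 2)}
    (hJf : J.IsFlapOn a d {b, c} id) {r : ℝ} (h0 : 0 < r) (h1 : r < 1)
    (he : AffineMap.lineMap d a r = AffineMap.lineMap b c (1 / 2 : ℝ)) :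
    φ 2 J d = h (EuclideanGeometry.angle b d c) ∧
      EuclideanGeometry.angle b d c ∈ Set.Ioo 0 Real.pi := by
  classical
  have hdc := hJf.symm.isCone
  -- Pulling `a` towards `d` as far as the segment `b c` flattens the kite to the triangle `d b c`
  -- with `b c` subdivided at its midpoint.
  obtain ⟨J', hJ', hiso, hφ⟩ := exists_shrink hstar hsub hI hS hJ hdc {a}
    (Finset.singleton_subset_iff.2 hJf.isCone.1) (by simpa using hJf.ne.symm) (fun _ => r)
    (fun _ _ => h0) (fun _ _ => h1)
  have hf := (hJf.symm.map hiso).image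
  have hb : shrinkMap d {a} (fun _ => r) b = b := shrinkMap_of_notMem (by
    simpa using hJf.ne_left b (by simp))
  have hc : shrinkMap d {a} (fun _ => r) c = c := shrinkMap_of_notMem (by
    simpa using hJf.ne_left c (by simp))
  have hd : shrinkMap d {a} (fun _ => r) d = d := shrinkMap_of_notMem (by
    simpa using hJf.ne.symm)
  have ha : shrinkMap d {a} (fun _ => r) a = AffineMap.lineMap d a r :=
    shrinkMap_of_mem (by simp)
  rw [hd, ha, he] at hf
  simp only [Function.comp_id, Finset.image_insert, Finset.image_singleton, hb, hc] at hf
  -- Otherwise the midpoint would lie on the same line, and the triangle of the flap with tip `b`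
  -- would be degenerate.
  have hnc : ¬ Collinear ℝ {d, b, c} := by
    intro hcol
    have hmem : AffineMap.lineMap b c (1 / 2 : ℝ) ∈
        affineSpan ℝ ({d, b, c} : Set (EuclideanSpace ℝ (Fin 2))) :=
      AffineMap.lineMap_mem _ (subset_affineSpan ℝ _ (by simp)) (subset_affineSpan ℝ _ (by simp))
    have hcol' := (collinear_insert_iff_of_mem_affineSpan hmem).2 hcol
    refine (hf.closedStar_isTriangle (i := b) (by simp)).not_collinear (hcol'.subset ?_)
    intro x hx
    simp only [id, Set.mem_insert_iff, Set.mem_singleton_iff] at hx ⊢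
    tauto
  obtain ⟨L, hL⟩ := exists_isTriangle hnc
  have hLT := hfan L hL.isPlanarFan
  have hbc : {b, c} ∈ L.faces := hL.rotate.isCone.edge_mem hL.rotate.rotate.isCone.1
  have hLf := hL.splitEdge_isFlapOn hbc (l := 1 / 2) (by norm_num) (by norm_num)
  have hsd := splitEdge_isSubdivision hbc hL.ne₃ (l := 1 / 2) (by norm_num) (by norm_num)
  have hLd : d ∈ L.verts := hL.isCone.1
  refine ⟨?_, hL.angle_mem_Ioo⟩
  rw [← hh 2 L hLT d b c hL, ← hφ, hf.ext hLf, hS 2 L hLT _ (hsub 2 L hLT _ hsd) d hLd hsd]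

/-- Let `d` be the midpoint of the edge `b c` of a triangle `a b c`. Moving `b` and `c` slightly
towards `a` gives kites whose angle at `d` tends to `π`. Their values at `d` are those of the affine
function, while continuity forces the limit to be the value 0 in the subdivided triangle. -/
theorem angle_function_at_pi (hstar : T.StarClosed) (hsub : T.SubdivisionClosed)
    (hfan : ∀ K : Complex2 2, K.IsPlanarFan → K ∈ T 2)
    (hΛ : GeometricallyLocallyDeterminedBy T Λ φ)
    (hΛfan : ∀ K : Complex2 2, K.IsPlanarFan → Λ 2 K = Λfan) {h : ℝ → ℝ}
    (hh : ∀ (N : ℕ), ∀ K ∈ T N, ∀ a b c : EuclideanSpace ℝ (Fin N), K.IsTriangle a b c →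
      φ N K a = h (EuclideanGeometry.angle b a c)) {m k : ℝ}
    (hmk : ∀ x ∈ Set.Ioo 0 Real.pi, h x = m + k * x) : m + k * Real.pi = 0 := by
  classical
  obtain ⟨hI, hS, hC, hD⟩ := hΛ
  have hp3 : 0 < Real.pi / 3 := by positivity
  obtain ⟨K, a, b, c, hK, -⟩ := exists_isTriangle_angles hp3 hp3 hp3 (by ring)
  have hbc : {b, c} ∈ K.faces := hK.rotate.isCone.edge_mem hK.rotate.rotate.isCone.1
  have l0 : (0 : ℝ) < 1 / 2 := by norm_num
  have l1 : (1 / 2 : ℝ) < 1 := by norm_num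
  have hJ0 := hfan _ (hK.splitEdge_isPlanarFan hbc l0 l1)
  have hJf := hK.splitEdge_isFlapOn hbc l0 l1
  have hzero := phi_midpoint_splitEdge hfan hS hD hΛfan hK hbc l0 l1
  generalize K.splitEdge b c (1 / 2) hbc hK.ne₃ l0 l1 = J0 at *
  have hsb : Sbtw ℝ b (AffineMap.lineMap b c (1 / 2 : ℝ)) c :=
    sbtw_lineMap_iff.2 ⟨hK.ne₃, l0, l1⟩
  have hpi := hsb.angle₁₂₃_eq_pi
  set d : EuclideanSpace ℝ (Fin 2) := AffineMap.lineMap b c (1 / 2 : ℝ) with hd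
  clear_value d
  -- Ratios strictly between 0 and 1 that tend to 1; the shift by 2 rules out the ratio 0 at `n =
  -- 0`.
  let t : ℕ → ℝ := fun n => 1 - 1 / ((n : ℝ) + 2)
  have tpos : ∀ n : ℕ, 0 < 1 / ((n : ℝ) + 2) := fun n => by positivity
  have tlt : ∀ n : ℕ, 1 / ((n : ℝ) + 2) < 1 := fun n => by
    rw [div_lt_one (by positivity)]
    linarith [(Nat.cast_nonneg n : (0 : ℝ) ≤ n)]
  have ht0 : ∀ n, 0 < t n := fun n => sub_pos.2 (tlt n)
  have ht1 : ∀ n, t n < 1 := fun n => sub_lt_self _ (tpos n)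
  have htlim : Filter.Tendsto t Filter.atTop (nhds 1) := by
    have : Filter.Tendsto (fun n : ℕ => 1 / ((n : ℝ) + 2)) Filter.atTop (nhds 0) :=
      tendsto_const_nhds.div_atTop
        (Filter.tendsto_atTop_add_const_right _ _ tendsto_natCast_atTop_atTop)
    have h2 := (tendsto_const_nhds (x := (1 : ℝ))).sub this
    rwa [sub_zero] at h2
  have hsubset : ({b, c} : Finset (EuclideanSpace ℝ (Fin 2))) ⊆ J0.verts := fun x hx =>
    (hJf.mem_verts_iff x).2 (Or.inr (Or.inr ⟨x, hx, rfl⟩))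
  have hna : a ∉ ({b, c} : Finset (EuclideanSpace ℝ (Fin 2))) := fun h => hJf.ne_left a h rfl
  have hnd : d ∉ ({b, c} : Finset (EuclideanSpace ℝ (Fin 2))) := fun h => hJf.ne_right d h rfl
  choose J hJ hiso _ using fun n => exists_shrink hstar hsub hI hS hJ0 hJf.isCone {b, c} hsubset
    hna (fun _ => t n) (fun _ _ => ht0 n) (fun _ _ => ht1 n)
  have hlim : ∀ x ∈ ({b, c} : Finset (EuclideanSpace ℝ (Fin 2))),
      Filter.Tendsto (fun n => AffineMap.lineMap a x (t n)) Filter.atTop (nhds x) := by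
    intro x _
    have hcont : Continuous fun r : ℝ => AffineMap.lineMap a x r := by
      simp only [AffineMap.lineMap_apply_module]
      fun_prop
    have h2 := (hcont.tendsto 1).comp htlim
    rw [AffineMap.lineMap_apply_one] at h2
    exact h2
  have hval : ∀ n, φ 2 (J n) d = m + k * EuclideanGeometry.angle (AffineMap.lineMap a b (t n)) d
      (AffineMap.lineMap a c (t n)) := by
    intro n
    have hf := (hJf.map (hiso n)).image
    rw [shrinkMap_of_notMem hna, shrinkMap_of_notMem hnd] at hf
    simp only [Function.comp_id, Finset.image_insert, Finset.image_singleton] at hf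
    rw [shrinkMap_of_mem (by simp), shrinkMap_of_mem (by simp)] at hf
    -- The homothety about `a` of ratio `t n` takes `d` to the midpoint of the moved `b` and `c`;
    -- this point divides the diagonal from `d` to `a` in the ratio `1 - t n : t n`.
    have he : AffineMap.lineMap d a (1 - t n) = AffineMap.lineMap (AffineMap.lineMap a b (t n))
        (AffineMap.lineMap a c (t n)) (1 / 2 : ℝ) := by
      simp only [hd, AffineMap.lineMap_apply_module]
      module
    obtain ⟨e1, e2⟩ := phi_kite hstar hsub hfan hI hS hh (hJ n) hf (sub_pos.2 (ht1 n))
      (by linarith [ht0 n]) he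
    rw [e1, hmk _ e2]
  have key := hC 2 J0 hJ0 J _ hJ hiso ?_ d hJf.symm.isCone.1
  · simp only [shrinkMap_of_notMem hnd, hval, hzero] at key
    have hbd : b ≠ d := hJf.ne_right b (by simp)
    have hcd : c ≠ d := hJf.ne_right c (by simp)
    have hang : Filter.Tendsto (fun n => EuclideanGeometry.angle (AffineMap.lineMap a b (t n)) d
        (AffineMap.lineMap a c (t n))) Filter.atTop (nhds Real.pi) := by
      have h1 := (hlim b (by simp)).prodMk_nhds
        ((tendsto_const_nhds (x := d)).prodMk_nhds (hlim c (by simp)))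
      have h2 := (EuclideanGeometry.continuousAt_angle (x := (b, d, c)) hbd hcd).tendsto
      have h3 := h2.comp h1
      simp only [hpi] at h3
      exact h3
    exact tendsto_nhds_unique (tendsto_const_nhds.add (hang.const_mul k)) key
  · intro x hx
    by_cases hxB : x ∈ ({b, c} : Finset (EuclideanSpace ℝ (Fin 2)))
    · simpa only [shrinkMap_of_mem hxB] using hlim x hxB
    · simp only [shrinkMap_of_notMem hxB]
      exact tendsto_const_nhds

/-- The value at a vertex of a triangle. -/
theorem phi_triangle (hstar : T.StarClosed) (hsub : T.SubdivisionClosed)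
    (hfan : ∀ K : Complex2 2, K.IsPlanarFan → K ∈ T 2)
    (hΛ : GeometricallyLocallyDeterminedBy T Λ φ)
    (hΛfan : ∀ K : Complex2 2, K.IsPlanarFan → Λ 2 K = Λfan)
    {K : Complex2 N} (hK : K ∈ T N) {a b c : EuclideanSpace ℝ (Fin N)} (h : K.IsTriangle a b c) :
    φ N K a = Λfan * (1 / 2 - EuclideanGeometry.angle b a c / (2 * Real.pi)) := by
  obtain ⟨f, hf⟩ := exists_angle_function hstar hsub hΛ.1 hΛ.2.1
  have hs : ∀ x y z : ℝ, 0 < x → 0 < y → 0 < z → x + y + z = Real.pi → f x + f y + f z = Λfan :=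
    fun x y z hx hy hz hxyz => sum_angle_function hfan hΛ.2.2.2 hΛfan hf hx hy hz hxyz
  obtain ⟨m, k, hmk⟩ := affine_of_triangle_sum (continuousOn_angle_function hfan hΛ.2.2.1 hf) hs
  have hpi := Real.pi_pos
  have e0 := angle_function_at_pi hstar hsub hfan hΛ hΛfan hf hmk
  have e1 := hs (Real.pi / 3) (Real.pi / 3) (Real.pi / 3) (by linarith) (by linarith)
    (by linarith) (by ring)
  rw [hmk _ ⟨by linarith, by linarith⟩] at e1
  rw [hf N K hK a b c h, hmk _ h.angle_mem_Ioo]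
  -- The equilateral triangle gives `3 * m + k * π = Λfan`, and `m + k * π = 0`.
  have hm : m = Λfan / 2 := by linarith
  have hk : k * Real.pi = -(Λfan / 2) := by linarith
  have hk' : k = -(Λfan / 2) / Real.pi := by
    rw [← hk]
    field_simp
  rw [hm, hk']
  field_simp
  ring

end VertexFunctions

/-! ### The values at the vertices of a flap -/

namespace Complex2

variable {N M : ℕ} {ι : Type*}

theorem IsFlapOn.isSimplicialIso {K : Complex2 N} {L : Complex2 M}
    {w v : EuclideanSpace ℝ (Fin N)} {w' v' : EuclideanSpace ℝ (Fin M)} {I : Finset ι}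
    {f : ι → EuclideanSpace ℝ (Fin N)} {f' : ι → EuclideanSpace ℝ (Fin M)}
    (h : K.IsFlapOn w v I f) (h' : L.IsFlapOn w' v' I f')
    {g : EuclideanSpace ℝ (Fin N) → EuclideanSpace ℝ (Fin M)} (hw : g w = w') (hv : g v = v')
    (hf : ∀ i ∈ I, g (f i) = f' i) : K.IsSimplicialIso L g := by
  classical
  subst hw hv
  refine isSimplicialIso_of_image ?_ (fun s hs => ?_) fun t ht => ?_
  · intro x hx y hy hxy
    obtain rfl | rfl | ⟨i, hi, rfl⟩ := (h.mem_verts_iff x).1 hx <;>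
    obtain rfl | rfl | ⟨j, hj, rfl⟩ := (h.mem_verts_iff y).1 hy
    · rfl
    · exact absurd hxy h'.ne
    · exact absurd (hxy.trans (hf j hj)).symm (h'.ne_left j hj)
    · exact absurd hxy.symm h'.ne
    · rfl
    · exact absurd (hxy.trans (hf j hj)).symm (h'.ne_right j hj)
    · exact absurd ((hf i hi).symm.trans hxy) (h'.ne_left i hi)
    · exact absurd ((hf i hi).symm.trans hxy) (h'.ne_right i hi)
    · rw [hf i hi, hf j hj] at hxy
      rw [h'.injOn hi hj hxy]
  · obtain ⟨hne, hs | ⟨i, hi, hs⟩⟩ := (h.mem_iff s).1 hs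
    · have hs' := Finset.image_subset_image (f := g) hs
      exact (h'.mem_iff _).2 ⟨hne.image g, Or.inl (by
        simpa only [Finset.image_insert, Finset.image_singleton] using hs')⟩
    · have hs' := Finset.image_subset_image (f := g) hs
      exact (h'.mem_iff _).2 ⟨hne.image g, Or.inr ⟨i, hi, by
        simpa only [Finset.image_insert, Finset.image_singleton, hf i hi] using hs'⟩⟩
  · obtain ⟨hne, ht | ⟨i, hi, ht⟩⟩ := (h'.mem_iff t).1 ht
    · rw [← Finset.image_singleton, ← Finset.image_insert, Finset.subset_image_iff] at ht
      obtain ⟨s, hs, rfl⟩ := ht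
      exact ⟨s, K.down_closed h.edge_mem (by exact_mod_cast hs) (Finset.image_nonempty.1 hne), rfl⟩
    · rw [← hf i hi, ← Finset.image_singleton, ← Finset.image_insert, ← Finset.image_insert,
        Finset.subset_image_iff] at ht
      obtain ⟨s, hs, rfl⟩ := ht
      exact ⟨s, K.down_closed (h.triangle_mem hi) (by exact_mod_cast hs)
        (Finset.image_nonempty.1 hne), rfl⟩

/-- A flap whose triangles are isosceles has an isometry that exchanges the ends. -/
theorem IsFlapOn.isSimplicialIsometry_swap {K : Complex2 N} {w v : EuclideanSpace ℝ (Fin N)}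
    {I : Finset ι} {f : ι → EuclideanSpace ℝ (Fin N)} (h : K.IsFlapOn w v I f)
    (hd : ∀ i ∈ I, dist (f i) w = dist (f i) v) :
    K.IsSimplicialIsometry K (Equiv.swap w v) := by
  have hf : ∀ i ∈ I, Equiv.swap w v (f i) = f i := fun i hi =>
    Equiv.swap_apply_of_ne_of_ne (h.ne_left i hi) (h.ne_right i hi)
  refine ⟨h.isSimplicialIso h.symm (Equiv.swap_apply_left _ _) (Equiv.swap_apply_right _ _) hf,
    fun a b hab => ?_⟩
  have hlr : ∀ x y, (x = w ∨ x = v) → (y = w ∨ y = v) →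
      dist (Equiv.swap w v x) (Equiv.swap w v y) = dist x y := by
    rintro x y (rfl | rfl) (rfl | rfl) <;> simp [dist_comm]
  obtain ⟨-, hs | ⟨i, hi, hs⟩⟩ := (h.mem_iff _).1 hab
  · have ha := hs (show a ∈ _ by simp)
    have hb := hs (show b ∈ _ by simp)
    simp only [Finset.mem_insert, Finset.mem_singleton] at ha hb
    exact hlr a b ha hb
  · have hi1 := hd i hi
    have hi2 : dist w (f i) = dist v (f i) := by rw [dist_comm, hi1, dist_comm]
    have ha := hs (show a ∈ _ by simp)
    have hb := hs (show b ∈ _ by simp)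
    simp only [Finset.mem_insert, Finset.mem_singleton] at ha hb
    obtain rfl | rfl | rfl := ha <;> obtain rfl | rfl | rfl := hb <;>
      simp [hf i hi, hi1, hi2, dist_comm]

end Complex2

section VertexFunctions

open Complex2

variable {N M : ℕ} {ι : Type*} {T : ComplexClass} {φ : VertexFunction} {Λ : ComplexFunction}
  {Λfan : ℝ} {Λflap : ℕ → ℝ}

/-- The star of a tip is a triangle. Its angle sum converts the angle at the tip into the two angles
at the ends, which is the form needed for the sums below. -/
theorem phi_flap_tip (hstar : T.StarClosed) (hsub : T.SubdivisionClosed)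
    (hfan : ∀ K : Complex2 2, K.IsPlanarFan → K ∈ T 2)
    (hΛ : GeometricallyLocallyDeterminedBy T Λ φ)
    (hΛfan : ∀ K : Complex2 2, K.IsPlanarFan → Λ 2 K = Λfan)
    {K : Complex2 N} (hK : K ∈ T N) {w v : EuclideanSpace ℝ (Fin N)} {I : Finset ι}
    {f : ι → EuclideanSpace ℝ (Fin N)} (h : K.IsFlapOn w v I f) {i : ι} (hi : i ∈ I) :
    φ N K (f i) = Λfan * ((EuclideanGeometry.angle (f i) w v +
      EuclideanGeometry.angle (f i) v w) / (2 * Real.pi)) := by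
  have hv : f i ∈ K.verts := (h.mem_verts_iff _).2 (Or.inr (Or.inr ⟨i, hi, rfl⟩))
  rw [← phi_closedStar hstar hΛ.1 hK hv, phi_triangle hstar hsub hfan hΛ hΛfan
    (hstar N K hK _ hv) (h.closedStar_isTriangle hi)]
  have hsum := EuclideanGeometry.angle_add_angle_add_angle_eq_pi (f i) h.ne
  rw [EuclideanGeometry.angle_comm v w] at hsum
  have hpi := Real.pi_ne_zero
  rw [show EuclideanGeometry.angle w (f i) v = Real.pi - (EuclideanGeometry.angle (f i) w v +
    EuclideanGeometry.angle (f i) v w) by linarith]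
  field_simp
  ring

/-- Acuteness at `w` means that each ray from `w` to a tip meets the perpendicular bisector of the
edge. With the tips there, the ends can be exchanged by an isometry and share equally what condition
4 leaves after the tips. -/
theorem phi_flap_of_acute (hstar : T.StarClosed) (hsub : T.SubdivisionClosed)
    (hfan : ∀ K : Complex2 2, K.IsPlanarFan → K ∈ T 2)
    (hΛ : GeometricallyLocallyDeterminedBy T Λ φ)
    (hΛfan : ∀ K : Complex2 2, K.IsPlanarFan → Λ 2 K = Λfan)
    (hΛflap : ∀ n N : ℕ, ∀ K ∈ T N, K.IsFlap n → Λ N K = Λflap n)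
    {K : Complex2 N} (hK : K ∈ T N) {w v : EuclideanSpace ℝ (Fin N)} {I : Finset ι}
    {f : ι → EuclideanSpace ℝ (Fin N)} (h : K.IsFlapOn w v I f)
    (hac : ∀ i ∈ I, 0 < inner ℝ (f i - w) (v - w)) :
    φ N K w = Λflap I.card / 2 -
      Λfan * ∑ i ∈ I, EuclideanGeometry.angle (f i) w v / (2 * Real.pi) := by
  classical
  have hu : 0 < ‖v - w‖ ^ 2 := by
    have : v - w ≠ 0 := sub_ne_zero.2 h.ne.symm
    positivity
  obtain ⟨e, he0, he1, he⟩ : ∃ e : ℝ, 0 < e ∧ e < 1 ∧ ∀ i ∈ I,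
      e * (‖v - w‖ ^ 2 / (2 * inner ℝ (f i - w) (v - w))) < 1 := by
    have h0 : ∀ᶠ e in nhdsWithin (0 : ℝ) (Set.Ioi 0), 0 < e := self_mem_nhdsWithin
    have h1 : ∀ᶠ e in nhdsWithin (0 : ℝ) (Set.Ioi 0), e < 1 :=
      nhdsWithin_le_nhds (eventually_lt_nhds one_pos)
    have h2 : ∀ᶠ e in nhdsWithin (0 : ℝ) (Set.Ioi 0), ∀ i ∈ I,
        e * (‖v - w‖ ^ 2 / (2 * inner ℝ (f i - w) (v - w))) < 1 :=
      (Filter.eventually_all_finset _).2 fun i _ => nhdsWithin_le_nhds <| by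
        have hc : Continuous fun e : ℝ => e * (‖v - w‖ ^ 2 / (2 * inner ℝ (f i - w) (v - w))) := by
          fun_prop
        exact (hc.tendsto 0).eventually (eventually_lt_nhds (by simp))
    obtain ⟨e, h0, h1, h2⟩ := (h0.and (h1.and h2)).exists
    exact ⟨e, h0, h1, h2⟩
  -- The end `v` is scaled by `e`, and each tip by the factor that puts its projection on the edge
  -- at the midpoint of the shortened edge. Small `e` keeps all factors below 1.
  let t : EuclideanSpace ℝ (Fin N) → ℝ := fun x =>
    if x = v then e else e * (‖v - w‖ ^ 2 / (2 * inner ℝ (x - w) (v - w)))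
  have tv : t v = e := if_pos rfl
  have tf : ∀ i ∈ I, t (f i) = e * (‖v - w‖ ^ 2 / (2 * inner ℝ (f i - w) (v - w))) :=
    fun i hi => if_neg (h.ne_right i hi)
  have hB : ∀ x ∈ K.verts.erase w, x = v ∨ ∃ i ∈ I, f i = x := fun x hx => by
    obtain ⟨hxw, hx⟩ := Finset.mem_erase.1 hx
    exact ((h.mem_verts_iff x).1 hx).resolve_left hxw
  have ht0 : ∀ x ∈ K.verts.erase w, 0 < t x := by
    intro x hx
    obtain rfl | ⟨i, hi, rfl⟩ := hB x hx
    · rwa [tv]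
    · rw [tf i hi]
      have := hac i hi
      positivity
  have ht1 : ∀ x ∈ K.verts.erase w, t x < 1 := by
    intro x hx
    obtain rfl | ⟨i, hi, rfl⟩ := hB x hx
    · rwa [tv]
    · rw [tf i hi]
      exact he i hi
  obtain ⟨K', hK', hiso, hφ⟩ := exists_shrink hstar hsub hΛ.1 hΛ.2.1 hK h.isCone (K.verts.erase w)
    (Finset.erase_subset _ _) (Finset.notMem_erase _ _) t ht0 ht1
  have hw' : shrinkMap w (K.verts.erase w) t w = w := shrinkMap_of_notMem (Finset.notMem_erase _ _)
  have hv' : shrinkMap w (K.verts.erase w) t v = AffineMap.lineMap w v e := by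
    rw [shrinkMap_of_mem (Finset.mem_erase.2 ⟨h.ne.symm, h.symm.isCone.1⟩), tv]
  have hf' : ∀ i ∈ I, shrinkMap w (K.verts.erase w) t (f i) = AffineMap.lineMap w (f i)
      (e * (‖v - w‖ ^ 2 / (2 * inner ℝ (f i - w) (v - w)))) := fun i hi => by
    rw [shrinkMap_of_mem (Finset.mem_erase.2 ⟨h.ne_left i hi,
      (h.mem_verts_iff _).2 (Or.inr (Or.inr ⟨i, hi, rfl⟩))⟩), tf i hi]
  have hang : ∀ i ∈ I, EuclideanGeometry.angle (shrinkMap w (K.verts.erase w) t (f i)) w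
      (shrinkMap w (K.verts.erase w) t v) = EuclideanGeometry.angle (f i) w v := fun i _ =>
    angle_shrinkMap ht0
  have hflap := h.map hiso
  rw [hw'] at hflap
  have hdist : ∀ i ∈ I, dist ((shrinkMap w (K.verts.erase w) t ∘ f) i) w =
      dist ((shrinkMap w (K.verts.erase w) t ∘ f) i) (shrinkMap w (K.verts.erase w) t v) := by
    intro i hi
    rw [Function.comp_apply, hf' i hi, hv', ← sq_eq_sq₀ dist_nonneg dist_nonneg, dist_eq_norm,
      dist_eq_norm]
    set r := e * (‖v - w‖ ^ 2 / (2 * inner ℝ (f i - w) (v - w))) with hr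
    have hr' : 2 * r * inner ℝ (f i - w) (v - w) = e * ‖v - w‖ ^ 2 := by
      have := (hac i hi).ne'
      rw [hr]
      field_simp
    have e1 : AffineMap.lineMap w (f i) r - w = r • (f i - w) := by
      rw [AffineMap.lineMap_apply_module]
      module
    have e2 : AffineMap.lineMap w (f i) r - AffineMap.lineMap w v e =
        r • (f i - w) - e • (v - w) := by
      simp only [AffineMap.lineMap_apply_module]
      module
    rw [e1, e2, norm_sub_sq_real, real_inner_smul_left, real_inner_smul_right, norm_smul e,
      mul_pow, Real.norm_eq_abs, sq_abs]
    linear_combination e * hr'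
  have hswap : φ N K' w = φ N K' (shrinkMap w (K.verts.erase w) t v) :=
    phi_eq_of_isometry hΛ.1 hK' hK' hflap.isCone hflap.symm.isCone
      (hflap.isSimplicialIsometry_swap hdist) (Equiv.swap_apply_left _ _)
  have hsum := hΛ.2.2.2 N K' hK'
  rw [hΛflap _ N K' hK' hflap.isFlap, hflap.sum_verts, ← hswap,
    Finset.sum_congr rfl fun i hi => phi_flap_tip hstar hsub hfan hΛ hΛfan hK' hflap hi] at hsum
  have hiso' : ∀ i ∈ I, Λfan * ((EuclideanGeometry.angle
      ((shrinkMap w (K.verts.erase w) t ∘ f) i) w (shrinkMap w (K.verts.erase w) t v) +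
      EuclideanGeometry.angle ((shrinkMap w (K.verts.erase w) t ∘ f) i)
        (shrinkMap w (K.verts.erase w) t v) w) / (2 * Real.pi)) =
      Λfan * 2 * (EuclideanGeometry.angle (f i) w v / (2 * Real.pi)) := by
    intro i hi
    -- The base angles of an isosceles triangle are equal, so each tip contributes twice the angle
    -- at `w`.
    rw [← EuclideanGeometry.angle_eq_angle_of_dist_eq (hdist i hi), Function.comp_apply, hang i hi]
    ring
  rw [Finset.sum_congr rfl hiso', ← Finset.mul_sum] at hsum
  rw [← hφ]
  linarith

/-- The value at an end of a flap. -/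
theorem phi_flap (hstar : T.StarClosed) (hsub : T.SubdivisionClosed)
    (hfan : ∀ K : Complex2 2, K.IsPlanarFan → K ∈ T 2)
    (hΛ : GeometricallyLocallyDeterminedBy T Λ φ)
    (hΛfan : ∀ K : Complex2 2, K.IsPlanarFan → Λ 2 K = Λfan)
    (hΛflap : ∀ n N : ℕ, ∀ K ∈ T N, K.IsFlap n → Λ N K = Λflap n)
    {K : Complex2 N} (hK : K ∈ T N) {w v : EuclideanSpace ℝ (Fin N)} {I : Finset ι}
    {f : ι → EuclideanSpace ℝ (Fin N)} (h : K.IsFlapOn w v I f) :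
    φ N K w = Λflap I.card / 2 -
      Λfan * ∑ i ∈ I, EuclideanGeometry.angle (f i) w v / (2 * Real.pi) := by
  classical
  have hu : 0 < ‖v - w‖ ^ 2 := by
    have : v - w ≠ 0 := sub_ne_zero.2 h.ne.symm
    positivity
  -- Once the tips are close enough to `w`, the angles at `v` are acute; this inequality is that
  -- condition for tips scaled by `e`.
  obtain ⟨e, he0, he1, he⟩ : ∃ e : ℝ, 0 < e ∧ e < 1 ∧ ∀ i ∈ I,
      e * inner ℝ (f i - w) (v - w) < ‖v - w‖ ^ 2 := by
    have h0 : ∀ᶠ e in nhdsWithin (0 : ℝ) (Set.Ioi 0), 0 < e := self_mem_nhdsWithin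
    have h1 : ∀ᶠ e in nhdsWithin (0 : ℝ) (Set.Ioi 0), e < 1 :=
      nhdsWithin_le_nhds (eventually_lt_nhds one_pos)
    have h2 : ∀ᶠ e in nhdsWithin (0 : ℝ) (Set.Ioi 0), ∀ i ∈ I,
        e * inner ℝ (f i - w) (v - w) < ‖v - w‖ ^ 2 :=
      (Filter.eventually_all_finset _).2 fun i _ => nhdsWithin_le_nhds <| by
        have hc : Continuous fun e : ℝ => e * inner ℝ (f i - w) (v - w) := by fun_prop
        exact (hc.tendsto 0).eventually (eventually_lt_nhds (by simpa using hu))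
    obtain ⟨e, h0, h1, h2⟩ := (h0.and (h1.and h2)).exists
    exact ⟨e, h0, h1, h2⟩
  have hB : I.image f ⊆ K.verts := fun x hx => by
    obtain ⟨i, hi, rfl⟩ := Finset.mem_image.1 hx
    exact (h.mem_verts_iff _).2 (Or.inr (Or.inr ⟨i, hi, rfl⟩))
  have hwB : w ∉ I.image f := fun hx => by
    obtain ⟨i, hi, h'⟩ := Finset.mem_image.1 hx
    exact h.ne_left i hi h'
  have hvB : v ∉ I.image f := fun hx => by
    obtain ⟨i, hi, h'⟩ := Finset.mem_image.1 hx
    exact h.ne_right i hi h'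
  obtain ⟨K', hK', hiso, hφ⟩ := exists_shrink hstar hsub hΛ.1 hΛ.2.1 hK h.isCone (I.image f)
    hB hwB (fun _ => e) (fun _ _ => he0) (fun _ _ => he1)
  have hflap := h.map hiso
  have hang : ∀ i, EuclideanGeometry.angle (shrinkMap w (I.image f) (fun _ => e) (f i)) w
      (shrinkMap w (I.image f) (fun _ => e) v) = EuclideanGeometry.angle (f i) w v := fun i =>
    angle_shrinkMap fun _ _ => he0
  rw [shrinkMap_of_notMem hwB, shrinkMap_of_notMem hvB] at hflap
  rw [shrinkMap_of_notMem hvB] at hang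
  have hac : ∀ i ∈ I, 0 < inner ℝ ((shrinkMap w (I.image f) (fun _ => e) ∘ f) i - v) (w - v) := by
    intro i hi
    rw [Function.comp_apply, shrinkMap_of_mem (Finset.mem_image_of_mem f hi)]
    have e1 : AffineMap.lineMap w (f i) e - v = e • (f i - w) - (v - w) := by
      rw [AffineMap.lineMap_apply_module]
      module
    rw [e1, ← neg_sub v w, inner_neg_right, inner_sub_left, real_inner_smul_left,
      real_inner_self_eq_norm_sq]
    linarith [he i hi]
  -- The value at `v` is now known. In condition 4 its angle terms cancel those of the tips at `v`,
  -- leaving half of the flap constant and the angles at `w`.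
  have hend := phi_flap_of_acute hstar hsub hfan hΛ hΛfan hΛflap hK' hflap.symm hac
  have hsum := hΛ.2.2.2 N K' hK'
  rw [hΛflap _ N K' hK' hflap.isFlap, hflap.sum_verts, hend,
    Finset.sum_congr rfl fun i hi => phi_flap_tip hstar hsub hfan hΛ hΛfan hK' hflap hi] at hsum
  simp only [Function.comp_apply, hang, add_div, mul_add, Finset.sum_add_distrib,
    ← Finset.mul_sum] at hsum
  rw [← hφ]
  linarith

end VertexFunctions

/-! ### Counting simplices and angles in the star of a vertex -/

namespace Complex2

variable {N : ℕ} {K : Complex2 N} {v : EuclideanSpace ℝ (Fin N)}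

theorem mem_trianglesAt {s : Finset (EuclideanSpace ℝ (Fin N))} :
    s ∈ K.trianglesAt v ↔ s ∈ K.faces ∧ s.card = 3 ∧ v ∈ s := by
  simp [trianglesAt, simplices, and_assoc]

theorem mem_verts_link {w : EuclideanSpace ℝ (Fin N)} :
    w ∈ (K.link v).verts ↔ w ≠ v ∧ {w, v} ∈ K.faces := by
  rw [mem_verts]
  change ({w} ∈ K.faces ∧ {v, w} ∈ K.faces ∧ v ∉ ({w} : Finset _)) ↔ _
  rw [Finset.pair_comm, Finset.mem_singleton]
  exact ⟨fun h => ⟨fun e => h.2.2 e.symm, h.2.1⟩, fun h => ⟨K.down_closed h.2 (by simp) (by simp),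
    h.2, fun e => h.1 e.symm⟩⟩

theorem mem_verts_closedStar {w : EuclideanSpace ℝ (Fin N)} :
    w ∈ (K.closedStar v).verts ↔ {w, v} ∈ K.faces := by
  rw [mem_verts]
  change ({w} ∈ K.faces ∧ {v, w} ∈ K.faces) ↔ _
  rw [Finset.pair_comm]
  exact ⟨fun h => h.2, fun h => ⟨K.down_closed h (by simp) (by simp), h⟩⟩

theorem sum_verts_closedStar (hv : v ∈ K.verts) (F : EuclideanSpace ℝ (Fin N) → ℝ) :
    ∑ x ∈ (K.closedStar v).verts, F x = F v + ∑ x ∈ (K.link v).verts, F x := by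
  rw [← Finset.sum_insert]
  · refine Finset.sum_congr ?_ fun _ _ => rfl
    ext x
    rw [Finset.mem_insert, mem_verts_closedStar, mem_verts_link]
    by_cases hx : x = v
    · simpa [hx] using (K.mem_verts v).1 hv
    · simp [hx]
  · simp [mem_verts_link]

open Classical in
/-- The third vertices of the triangles that contain `v` and `w`. -/
noncomputable def commonNeighbors (K : Complex2 N) (v w : EuclideanSpace ℝ (Fin N)) :
    Finset (EuclideanSpace ℝ (Fin N)) :=
  K.verts.filter fun x => x ≠ w ∧ x ≠ v ∧ {w, v, x} ∈ K.faces

theorem mem_commonNeighbors {w x : EuclideanSpace ℝ (Fin N)} :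
    x ∈ K.commonNeighbors v w ↔ x ≠ w ∧ x ≠ v ∧ {w, v, x} ∈ K.faces := by
  classical
  refine Finset.mem_filter.trans (and_iff_right_iff_imp.2 ?_)
  exact fun h => K.subset_verts h.2.2 (by simp)

/-- The stars of the vertices of the link of `v`, in the star of `v`, are flaps. -/
theorem closedStar_closedStar_isFlapOn {w : EuclideanSpace ℝ (Fin N)} (hwv : w ≠ v)
    (hw : {w, v} ∈ K.faces) :
    ((K.closedStar v).closedStar w).IsFlapOn w v (K.commonNeighbors v w) id := by
  refine ⟨hwv, Set.injOn_id _, fun x hx => (mem_commonNeighbors.1 hx).1,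
    fun x hx => (mem_commonNeighbors.1 hx).2.1, fun s => ?_⟩
  change ((s ∈ K.faces ∧ insert v s ∈ K.faces) ∧ insert w s ∈ K.faces ∧
    insert v (insert w s) ∈ K.faces) ↔ _
  constructor
  · rintro ⟨⟨hs, -⟩, -, h⟩
    refine ⟨K.nonempty_of_mem_faces hs, ?_⟩
    by_cases hsub : s ⊆ {w, v}
    · exact Or.inl hsub
    · obtain ⟨x, hxs, hx⟩ := Finset.not_subset.1 hsub
      simp only [Finset.mem_insert, Finset.mem_singleton, not_or] at hx
      have hsub : {w, v, x} ⊆ insert v (insert w s) := by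
        intro y hy
        simp only [Finset.mem_insert, Finset.mem_singleton] at hy ⊢
        obtain rfl | rfl | rfl := hy <;> simp [hxs]
      have h3 : ({w, v, x} : Finset (EuclideanSpace ℝ (Fin N))).card = 3 :=
        Finset.card_eq_three.2 ⟨w, v, x, hwv, Ne.symm hx.1, Ne.symm hx.2, rfl⟩
      -- Dimension at most two: a simplex containing `w`, `v` and `x` has no further vertices.
      have heq := Finset.eq_of_subset_of_card_le hsub (h3.symm ▸ K.card_le_three _ h)
      refine Or.inr ⟨x, mem_commonNeighbors.2 ⟨hx.1, hx.2, heq ▸ h⟩, ?_⟩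
      rw [id, heq]
      exact (Finset.subset_insert _ _).trans (Finset.subset_insert _ _)
  · rintro ⟨hne, hs⟩
    have key : insert v (insert w s) ∈ K.faces := by
      obtain hs | ⟨x, hx, hs⟩ := hs
      · exact K.down_closed hw (Finset.insert_subset (by simp) (Finset.insert_subset (by simp) hs))
          (Finset.insert_nonempty _ _)
      · exact K.down_closed (mem_commonNeighbors.1 hx).2.2
          (Finset.insert_subset (by simp) (Finset.insert_subset (by simp) hs))
          (Finset.insert_nonempty _ _)
    have h2 : insert w s ∈ K.faces :=
      K.down_closed key (Finset.subset_insert _ _) (Finset.insert_nonempty _ _)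
    exact ⟨⟨K.down_closed h2 (Finset.subset_insert _ _) hne, K.down_closed key
      (Finset.insert_subset_insert _ (Finset.subset_insert _ _)) (Finset.insert_nonempty _ _)⟩,
      h2, key⟩

theorem injOn_commonNeighbors {w : EuclideanSpace ℝ (Fin N)} :
    Set.InjOn (fun x => ({w, v, x} : Finset (EuclideanSpace ℝ (Fin N))))
      (K.commonNeighbors v w) := by
  intro x hx y hy hxy
  have hx' := mem_commonNeighbors.1 hx
  have : x ∈ ({w, v, y} : Finset (EuclideanSpace ℝ (Fin N))) := by
    rw [← show ({w, v, x} : Finset (EuclideanSpace ℝ (Fin N))) = {w, v, y} from hxy]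
    simp
  simpa [hx'.1, hx'.2.1] using this

theorem image_commonNeighbors {w : EuclideanSpace ℝ (Fin N)} (hwv : w ≠ v) :
    (K.commonNeighbors v w).image (fun x => {w, v, x}) =
      (K.trianglesAt v).filter fun s => w ∈ s := by
  ext s
  simp only [Finset.mem_image, Finset.mem_filter, mem_trianglesAt, mem_commonNeighbors]
  constructor
  · rintro ⟨x, ⟨hxw, hxv, hx⟩, rfl⟩
    exact ⟨⟨hx, Finset.card_eq_three.2 ⟨w, v, x, hwv, Ne.symm hxw, Ne.symm hxv, rfl⟩, by simp⟩,
      by simp⟩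
  · rintro ⟨⟨hs, h3, hv⟩, hw⟩
    have h2 : ((s.erase w).erase v).card = 1 := by
      rw [Finset.card_erase_of_mem (Finset.mem_erase.2 ⟨hwv.symm, hv⟩),
        Finset.card_erase_of_mem hw, h3]
    obtain ⟨x, hx⟩ := Finset.card_eq_one.1 h2
    have hxs : x ∈ (s.erase w).erase v := by simp [hx]
    have heq : {w, v, x} = s := by
      rw [← hx, Finset.insert_erase (Finset.mem_erase.2 ⟨hwv.symm, hv⟩), Finset.insert_erase hw]
    simp only [Finset.mem_erase] at hxs
    exact ⟨x, ⟨hxs.2.1, hxs.1, heq ▸ hs⟩, heq⟩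

theorem card_commonNeighbors {w : EuclideanSpace ℝ (Fin N)} (hwv : w ≠ v) :
    (K.commonNeighbors v w).card = K.edgeOrder w v := by
  rw [← Finset.card_image_of_injOn (injOn_commonNeighbors (K := K)), image_commonNeighbors hwv,
    edgeOrder]
  congr 1
  ext s
  simp only [Finset.mem_filter, mem_trianglesAt]
  tauto

theorem sum_commonNeighbors {w : EuclideanSpace ℝ (Fin N)} (hwv : w ≠ v) :
    ∑ x ∈ K.commonNeighbors v w, EuclideanGeometry.angle x w v / (2 * Real.pi) =
      ∑ s ∈ (K.trianglesAt v).filter (fun s => w ∈ s), normAngle w s := by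
  rw [← image_commonNeighbors hwv, Finset.sum_image (injOn_commonNeighbors (K := K))]
  refine Finset.sum_congr rfl fun x hx => ?_
  have hx' := mem_commonNeighbors.1 hx
  rw [normAngle_triple hwv hx'.1.symm hx'.2.1.symm, EuclideanGeometry.angle_comm]

/-- The normalized angles of a triangle add up to `1 / 2`. -/
theorem sum_normAngle_erase {s : Finset (EuclideanSpace ℝ (Fin N))} (hs : s ∈ K.trianglesAt v) :
    ∑ w ∈ s.erase v, normAngle w s = 1 / 2 - normAngle v s := by
  obtain ⟨-, h3, hv⟩ := mem_trianglesAt.1 hs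
  have h2 : (s.erase v).card = 2 := by rw [Finset.card_erase_of_mem hv, h3]
  obtain ⟨a, b, hab, he⟩ := Finset.card_eq_two.1 h2
  have hav : v ≠ a := fun h => Finset.notMem_erase v s (by rw [he, h]; simp)
  have hbv : v ≠ b := fun h => Finset.notMem_erase v s (by rw [he, h]; simp)
  have hs' : s = {v, a, b} := by rw [← he, Finset.insert_erase hv]
  rw [he, Finset.sum_pair hab, hs', normAngle_triple hav hbv hab]
  have ea : ({v, a, b} : Finset (EuclideanSpace ℝ (Fin N))) = {a, v, b} := Finset.insert_comm _ _ _
  have eb : ({v, a, b} : Finset (EuclideanSpace ℝ (Fin N))) = {b, v, a} := by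
    rw [Finset.pair_comm a b, Finset.insert_comm]
  rw [show normAngle a {v, a, b} = _ from by rw [ea, normAngle_triple hav.symm hab hbv],
    show normAngle b {v, a, b} = _ from by rw [eb, normAngle_triple hbv.symm hab.symm hav]]
  have hsum := EuclideanGeometry.angle_add_angle_add_angle_eq_pi b hav.symm
  rw [EuclideanGeometry.angle_comm a b v, EuclideanGeometry.angle_comm b v a] at hsum
  have hpi := Real.pi_ne_zero
  rw [show EuclideanGeometry.angle a v b = Real.pi - EuclideanGeometry.angle v a b -
    EuclideanGeometry.angle v b a by linarith]
  field_simp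
  ring

/-- Double counting of the angles at the vertices of the link. -/
theorem sum_link_normAngle :
    ∑ w ∈ (K.link v).verts, ∑ s ∈ (K.trianglesAt v).filter (fun s => w ∈ s), normAngle w s =
      ∑ s ∈ K.trianglesAt v, (1 / 2 - normAngle v s) := by
  simp_rw [Finset.sum_filter]
  rw [Finset.sum_comm]
  refine Finset.sum_congr rfl fun s hs => ?_
  rw [← sum_normAngle_erase hs, ← Finset.sum_filter]
  refine Finset.sum_congr ?_ fun _ _ => rfl
  obtain ⟨hsK, -, hv⟩ := mem_trianglesAt.1 hs
  ext w
  simp only [Finset.mem_filter, mem_verts_link, Finset.mem_erase]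
  constructor
  · rintro ⟨⟨h1, -⟩, h2⟩
    exact ⟨h1, h2⟩
  · rintro ⟨h1, h2⟩
    exact ⟨⟨h1, K.down_closed hsK (by simp [Finset.insert_subset_iff, h2, hv])
      (Finset.insert_nonempty _ _)⟩, h2⟩

/-- Adding `v` to an edge of the link and removing `v` from a triangle are inverse to each other. -/
theorem faceCount_link : (K.link v).faceCount 1 = (K.trianglesAt v).card := by
  rw [faceCount]
  have hmem : ∀ s, s ∈ (K.link v).simplices 1 ↔
      s ∈ K.faces ∧ insert v s ∈ K.faces ∧ v ∉ s ∧ s.card = 2 := by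
    intro s
    simp only [simplices, Finset.mem_filter, Set.Finite.mem_toFinset]
    change (s ∈ K.faces ∧ insert v s ∈ K.faces ∧ v ∉ s) ∧ s.card = 1 + 1 ↔ _
    tauto
  refine Finset.card_bij' (fun s _ => insert v s) (fun s _ => s.erase v) ?_ ?_ ?_ ?_
  · intro s hs
    obtain ⟨-, h2, h3, h4⟩ := (hmem s).1 hs
    exact mem_trianglesAt.2 ⟨h2, by rw [Finset.card_insert_of_notMem h3, h4], by simp⟩
  · intro s hs
    obtain ⟨h1, h2, h3⟩ := mem_trianglesAt.1 hs
    have h4 : (s.erase v).card = 2 := by rw [Finset.card_erase_of_mem h3, h2]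
    exact (hmem _).2 ⟨K.down_closed h1 (Finset.erase_subset _ _)
      (Finset.card_pos.1 (by omega)), by rwa [Finset.insert_erase h3], by simp, h4⟩
  · intro s hs
    exact Finset.erase_insert ((hmem s).1 hs).2.2.1
  · intro s hs
    exact Finset.insert_erase (mem_trianglesAt.1 hs).2.2

end Complex2

/-! ### The formula for the value at a vertex -/

theorem theorem2p7
    (T : ComplexClass)
    (hstar : ComplexClass.StarClosed T)
    (hsub : ComplexClass.SubdivisionClosed T)
    (hfan : ∀ K : Complex2 2, K.IsPlanarFan → K ∈ T 2)
    (Λ : ComplexFunction) (φ : VertexFunction)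
    (hΛ : GeometricallyLocallyDeterminedBy T Λ φ)
    (Λfan : ℝ) (hΛfan : ∀ K : Complex2 2, K.IsPlanarFan → Λ 2 K = Λfan)
    (Λflap : ℕ → ℝ)
    (hΛflap : ∀ n N : ℕ, ∀ K ∈ T N, K.IsFlap n → Λ N K = Λflap n)
    (N : ℕ) (K : Complex2 N) (hK : K ∈ T N)
    (v : EuclideanSpace ℝ (Fin N)) (hv : v ∈ K.verts) :
    φ N K v =
      Λ N (K.closedStar v)
        - 1 / 2 * ∑ w ∈ (K.link v).verts, Λflap (K.edgeOrder w v)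
        + 1 / 2 * Λfan * ((K.link v).faceCount 1 : ℝ)
        - Λfan * ∑ s ∈ K.trianglesAt v, normAngle v s := by
  have hS := hstar N K hK v hv
  have hsum := hΛ.2.2.2 N _ hS
  have hlink : ∀ w ∈ (K.link v).verts, φ N (K.closedStar v) w = Λflap (K.edgeOrder w v) / 2 -
      Λfan * ∑ s ∈ (K.trianglesAt v).filter (fun s => w ∈ s), normAngle w s := by
    intro w hw
    obtain ⟨hwv, hwK⟩ := Complex2.mem_verts_link.1 hw
    have hwS : w ∈ (K.closedStar v).verts := Complex2.mem_verts_closedStar.2 hwK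
    -- Inside the star of `v`, the star of `w` consists of the edge `⟨w, v⟩`, the triangles
    -- containing it, and their faces: a flap with end `w`.
    rw [← phi_closedStar hstar hΛ.1 hS hwS, phi_flap hstar hsub hfan hΛ hΛfan hΛflap
      (hstar N _ hS w hwS) (Complex2.closedStar_closedStar_isFlapOn hwv hwK),
      Complex2.card_commonNeighbors hwv, ← Complex2.sum_commonNeighbors hwv]
    simp only [id]
  -- Interchanging the sums over link vertices and triangles replaces the angles at the link by `1 /
  -- 2` minus the angle at `v` for each triangle; the constants `1 / 2` give the term with the
  -- number of edges of the link.
  rw [Complex2.sum_verts_closedStar hv, Finset.sum_congr rfl hlink, Finset.sum_sub_distrib,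
    ← Finset.mul_sum, Complex2.sum_link_normAngle, Finset.sum_sub_distrib, Finset.sum_const,
    ← Finset.sum_div, phi_closedStar hstar hΛ.1 hK hv, nsmul_eq_mul] at hsum
  rw [Complex2.faceCount_link]
  linarith
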